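/- **Setting.** Let $n\ge 1$, $p\ge 1$, $L\ge 2$. Let $(X,Y)$ be a random pair with $X\in\mathbb R^p$, $\mathbb E X=0$, and $Y\in\{\mathbf e_1,\dots,\mathbf e_L\}$, the canonical basis of $\mathbb R^L$, with $\pi_\ell=\mathbb P\{Y=\mathbf e_\ell\}>0$ and $X\mid Y=\mathbf e_\ell\sim\mathcal N_p(\mu_\ell,\Sigma_W)$ for all $\ell\in[L]$, where $\Sigma_W$ is positive definite. Put $M=(\mu_1,\dots,\mu_L)$, $B^*=\Sigma_W^{-1}M$ and $B=[\mathrm{Cov}(X)]^{-1}\mathrm{Cov}(X,Y)\in\mathbb R^{p\times L}$. Let $(X_1,Y_1),\dots,(X_n,Y_n)$ be i.i.d. copies of $(X,Y)$, let $\mathbf X\in\mathbb R^{n\times p}$ and $\mathbf Y\in\mathbb R^{n\times L}$ be the matrices with rows $X_i^\top$ and $Y_i^\top$, and put $\widehat M=(\widehat\mu_1,\dots,\widehat\mu_L)=\mathbf X^\top\mathbf Y(\mathbf Y^\top\mathbf Y)^{-1}$. For an estimator $\widehat B$ of $B$, put $$\widehat H=\tfrac1n\bigl(\mathbf Y^\top\mathbf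 Y-\widehat B^\top\mathbf X^\top\mathbf X\widehat B\bigr),\qquad \widehat B^*=\widehat B\widehat H^{+},$$ where $^+$ is the Moore–Penrose inverse, and, for a number $\Delta>0$, $$\mathcal Q(\widehat B^*)=\|\Sigma_W^{1/2}(\widehat B^*-B^*)\|_F^2\,(\Delta+\log n)+\sum_{\ell=1}^L\bigl[(\widehat\mu_\ell-\mu_\ell)^\top(\widehat B^*_\ell-B^*_\ell)\bigr]^2,$$ where the subscript $\ell$ denotes the $\ell$-th column. Write $\|A\|_{1,2}=\sum_i\|A_{i\cdot}\|_2$ for the sum of the Euclidean norms of the rows of $A$. **Theorem.** Let positive constants $c_\pi\le C_\pi$, $c_s\le C_s$, $c_\Delta\le C_\Delta$, $c_W\le C_W$ be given. There are constants $c>0$ and $C>0$, depending only on these eight constants, such that the following holds for all $n,p,L$ and all distributions of $(X,Y)$ as above. Assume that 1. $c_\pi/L\le\pi_\ell\le C_\pi/L$ for all $\ell\in[L]$; 2. $c_s\Delta\le(\mu_k-\mu_\ell)^\top\Sigma_W^{-1}(\mu_k-\mu_\ell)\le C_s\Delta$ for all $k\ne\ell$, and $c_\Delta\le\Delta\le C_\Delta$;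 3. the smallest eigenvalue of $\Sigma_W$ is greater than $c_W$, and all entries of $\Sigma_W$ are at most $C_W$ in absolute value; 4. $L\log n\le c\,n$. Let $\omega_1,\omega_2$ be deterministic numbers with $\omega_2\sqrt L\le c$ and let $\widehat B$ be any estimator of $B$ such that, with probability at least $1-n^{-1}$, $$\max\bigl\{n^{-1/2}\|\mathbf X(\widehat B-B)\|_F,\ \|\Sigma_W^{1/2}(\widehat B-B)\|_F\bigr\}\le\omega_2\quad\text{and}\quad\|\widehat B-B\|_{1,2}\le\omega_1 .$$ Then, with probability at least $1-2n^{-1}$, the matrix $\widehat H$ is invertible and $$\mathcal Q(\widehat B^*)\le C\left\{\frac{L^2\log^2 n}{n}+\omega_2^2L^2\log n+\omega_1^2L^3\,\frac{\log(n\vee p)}{n}\right\}.$$ -/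

import Mathlib

open MeasureTheory ProbabilityTheory Matrix
open scoped MatrixOrder

namespace LDARegression

/-! ### Matrix notions -/

section MatrixNotions

variable {ι κ : Type*} [Fintype ι] [Fintype κ]

/-- The Frobenius norm `‖A‖_F`. -/
noncomputable def frobNorm (A : Matrix ι κ ℝ) : ℝ :=
  Real.sqrt (∑ i, ∑ j, A i j ^ 2)

/-- The `ℓ₁/ℓ₂` norm `‖A‖_{1,2}`: the sum of the Euclidean norms of the rows of `A`. -/
noncomputable def norm12 (A : Matrix ι κ ℝ) : ℝ :=
  ∑ i, Real.sqrt (∑ j, A i j ^ 2)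

/-- The four Penrose equations: `P` is a Moore-Penrose inverse of the real matrix `A`. -/
structure IsMoorePenrose (A : Matrix ι κ ℝ) (P : Matrix κ ι ℝ) : Prop where
  mul_mul_self : A * P * A = A
  self_mul_mul : P * A * P = P
  symm_left : (A * P)ᵀ = A * P
  symm_right : (P * A)ᵀ = P * A

theorem IsMoorePenrose.unique {A : Matrix ι κ ℝ} {P Q : Matrix κ ι ℝ}
    (hP : IsMoorePenrose A P) (hQ : IsMoorePenrose A Q) : P = Q := by
  have h1 : A * P = A * Q := by
    calc A * P = (A * P)ᵀ := hP.symm_left.symm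
      _ = (A * Q * A * P)ᵀ := by rw [hQ.mul_mul_self]
      _ = ((A * Q) * (A * P))ᵀ := by simp only [Matrix.mul_assoc]
      _ = (A * P) * (A * Q) := by rw [transpose_mul, hP.symm_left, hQ.symm_left]
      _ = A * P * A * Q := by simp only [Matrix.mul_assoc]
      _ = A * Q := by rw [hP.mul_mul_self]
  have h2 : P * A = Q * A := by
    calc P * A = (P * A)ᵀ := hP.symm_right.symm
      _ = (P * (A * Q * A))ᵀ := by rw [hQ.mul_mul_self]
      _ = ((P * A) * (Q * A))ᵀ := by simp only [Matrix.mul_assoc]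
      _ = (Q * A) * (P * A) := by rw [transpose_mul, hP.symm_right, hQ.symm_right]
      _ = Q * (A * P * A) := by simp only [Matrix.mul_assoc]
      _ = Q * A := by rw [hP.mul_mul_self]
  calc P = P * A * P := hP.self_mul_mul.symm
    _ = Q * (A * P) := by rw [h2, Matrix.mul_assoc]
    _ = Q * A * Q := by rw [h1, Matrix.mul_assoc]
    _ = Q := hQ.self_mul_mul

theorem exists_isMoorePenrose (A : Matrix ι κ ℝ) : ∃ P, IsMoorePenrose A P := by
  classical
  have hS : (Aᵀ * A).IsHermitian := by
    simp [Matrix.IsHermitian, conjTranspose_eq_transpose_of_trivial]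
  obtain ⟨U, d, hU, hSd⟩ : ∃ (U : Matrix κ κ ℝ) (d : κ → ℝ), Uᵀ * U = 1 ∧
      Aᵀ * A = U * diagonal d * Uᵀ := by
    refine ⟨hS.eigenvectorUnitary, hS.eigenvalues, ?_, ?_⟩
    · have := Unitary.coe_star_mul_self hS.eigenvectorUnitary
      simpa [star_eq_conjTranspose, conjTranspose_eq_transpose_of_trivial] using this
    · have := hS.spectral_theorem
      simpa [Unitary.conjStarAlgAut_apply, star_eq_conjTranspose,
        conjTranspose_eq_transpose_of_trivial, Function.comp_def] using this
  set G : Matrix κ κ ℝ := U * diagonal (fun i => (d i)⁻¹) * Uᵀ with hG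
  have key : ∀ X Y : Matrix κ κ ℝ, (U * X * Uᵀ) * (U * Y * Uᵀ) = U * (X * Y) * Uᵀ := by
    intro X Y
    calc (U * X * Uᵀ) * (U * Y * Uᵀ) = U * X * (Uᵀ * U) * Y * Uᵀ := by
          simp only [Matrix.mul_assoc]
      _ = U * (X * Y) * Uᵀ := by rw [hU]; simp only [Matrix.mul_assoc, Matrix.one_mul]
  have hGt : Gᵀ = G := by
    simp [hG, transpose_mul, Matrix.mul_assoc]
  have hcomm : G * (Aᵀ * A) = (Aᵀ * A) * G := by
    rw [hSd, hG, key, key]; simp [mul_comm]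
  have hSGS : (Aᵀ * A) * G * (Aᵀ * A) = Aᵀ * A := by
    rw [hSd, hG, key, key]; simp
  have hGSG : G * (Aᵀ * A) * G = G := by
    have hd : ∀ i, (d i)⁻¹ * d i * (d i)⁻¹ = (d i)⁻¹ := fun i => by
      by_cases h : d i = 0 <;> simp [h]
    rw [hSd, hG, key, key]; simp [hd]
  refine ⟨G * Aᵀ, ?_, ?_, ?_, ?_⟩
  · have h0 : Aᴴ * A * (G * (Aᵀ * A) - 1) = 0 := by
      rw [conjTranspose_eq_transpose_of_trivial, Matrix.mul_sub, ← Matrix.mul_assoc, hSGS,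
        Matrix.mul_one, sub_self]
    have h1 := (conjTranspose_mul_self_mul_eq_zero A _).1 h0
    rw [Matrix.mul_sub, Matrix.mul_one, sub_eq_zero] at h1
    simpa only [Matrix.mul_assoc] using h1
  · calc G * Aᵀ * A * (G * Aᵀ) = (G * (Aᵀ * A) * G) * Aᵀ := by simp only [Matrix.mul_assoc]
      _ = G * Aᵀ := by rw [hGSG]
  · simp [transpose_mul, hGt, Matrix.mul_assoc]
  · calc (G * Aᵀ * A)ᵀ = (Aᵀ * A) * G := by simp [transpose_mul, hGt, Matrix.mul_assoc]
      _ = G * Aᵀ * A := by rw [← hcomm, ← Matrix.mul_assoc]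

/-- The Moore-Penrose inverse `A⁺` of a real matrix. -/
noncomputable def pinv (A : Matrix ι κ ℝ) : Matrix κ ι ℝ :=
  (exists_isMoorePenrose A).choose

theorem pinv_spec (A : Matrix ι κ ℝ) : IsMoorePenrose A (pinv A) :=
  (exists_isMoorePenrose A).choose_spec

end MatrixNotions

/-! ### The population -/

section Population

variable {p L : ℕ}

/-- The feature-label pairs `(x, ℓ)`. The label `ℓ` stands for the canonical basis vector
`e_ℓ` of `ℝ^L`. -/
abbrev Obs (p L : ℕ) : Type := EuclideanSpace ℝ (Fin p) × Fin L

/-- The `k`-th coordinate of the canonical basis vector `e_ℓ`. -/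
def oneHot (ℓ k : Fin L) : ℝ := if ℓ = k then 1 else 0

/-- The class probability `π_ℓ = ℙ(Y = e_ℓ)` under the law `P` of `(X, Y)`. -/
noncomputable def classProb (P : Measure (Obs p L)) (ℓ : Fin L) : ℝ :=
  P.real {z | z.2 = ℓ}

/-- `P` is the law of a pair `(X, Y)` from the Gaussian LDA model: every class has positive
probability, `X | Y = e_ℓ ∼ N(μ_ℓ, Σ_W)` with `μ_ℓ` the `ℓ`-th column of `M`, the within-class
covariance matrix `Σ_W` is positive definite, and `𝔼 X = 0`. -/
structure IsLDAModel (P : Measure (Obs p L)) (M : Matrix (Fin p) (Fin L) ℝ)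
    (SW : Matrix (Fin p) (Fin p) ℝ) : Prop where
  isProbabilityMeasure : IsProbabilityMeasure P
  posDef : SW.PosDef
  classProb_pos : ∀ ℓ, 0 < classProb P ℓ
  gaussian : ∀ ℓ : Fin L,
    HasLaw Prod.fst (multivariateGaussian (WithLp.toLp 2 (fun j => M j ℓ)) SW)
      (ProbabilityTheory.cond P {z | z.2 = ℓ})
  mean_zero : ∀ j : Fin p, ∫ z, z.1 j ∂P = 0

/-- `Σ = Cov(X)`. -/
noncomputable def covX (P : Measure (Obs p L)) : Matrix (Fin p) (Fin p) ℝ :=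
  Matrix.of fun i j => covariance (fun z : Obs p L => z.1 i) (fun z => z.1 j) P

/-- `Cov(X, Y)`. -/
noncomputable def covXY (P : Measure (Obs p L)) : Matrix (Fin p) (Fin L) ℝ :=
  Matrix.of fun i ℓ => covariance (fun z : Obs p L => z.1 i) (fun z => oneHot z.2 ℓ) P

/-- The regression matrix `B = Cov(X)⁻¹ Cov(X, Y)`. -/
noncomputable def regB (P : Measure (Obs p L)) : Matrix (Fin p) (Fin L) ℝ :=
  (covX P)⁻¹ * covXY P

/-- The discriminant directional matrix `B* = Σ_W⁻¹ M`. -/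
noncomputable def discB (SW : Matrix (Fin p) (Fin p) ℝ) (M : Matrix (Fin p) (Fin L) ℝ) :
    Matrix (Fin p) (Fin L) ℝ :=
  SW⁻¹ * M

/-- The squared Mahalanobis distance `(μ_k - μ_ℓ)ᵀ Σ_W⁻¹ (μ_k - μ_ℓ)`. -/
noncomputable def mahal (SW : Matrix (Fin p) (Fin p) ℝ) (M : Matrix (Fin p) (Fin L) ℝ)
    (k ℓ : Fin L) : ℝ :=
  (fun j => M j k - M j ℓ) ⬝ᵥ (SW⁻¹ *ᵥ (fun j => M j k - M j ℓ))

end Population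

/-! ### The sample and the estimators -/

section Sample

variable {n p L : ℕ}

/-- The feature matrix `𝐗`, with rows `X_i`. -/
def featMat (D : Fin n → Obs p L) : Matrix (Fin n) (Fin p) ℝ :=
  Matrix.of fun i j => (D i).1 j

/-- The response matrix `𝐘`, with rows `Y_i`. -/
def respMat (D : Fin n → Obs p L) : Matrix (Fin n) (Fin L) ℝ :=
  Matrix.of fun i ℓ => oneHot (D i).2 ℓ

/-- `M̂ = 𝐗ᵀ 𝐘 (𝐘ᵀ 𝐘)⁻¹`. -/
noncomputable def meanEst (D : Fin n → Obs p L) : Matrix (Fin p) (Fin L) ℝ :=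
  (featMat D)ᵀ * respMat D * ((respMat D)ᵀ * respMat D)⁻¹

/-- The plug-in matrix `Ĥ = n⁻¹ (𝐘ᵀ 𝐘 - B̂ᵀ 𝐗ᵀ 𝐗 B̂)`. -/
noncomputable def plugH (D : Fin n → Obs p L) (Bhat : Matrix (Fin p) (Fin L) ℝ) :
    Matrix (Fin L) (Fin L) ℝ :=
  (1 / (n : ℝ)) • ((respMat D)ᵀ * respMat D - Bhatᵀ * (featMat D)ᵀ * featMat D * Bhat)

/-- `B̂* = B̂ Ĥ⁺`. -/
noncomputable def discEst (D : Fin n → Obs p L) (Bhat : Matrix (Fin p) (Fin L) ℝ) :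
    Matrix (Fin p) (Fin L) ℝ :=
  Bhat * pinv (plugH D Bhat)

/-- The error measure `𝒬(A)` of an estimate `A` of `B*`:
`‖Σ_W^{1/2} (A - B*)‖_F² (Δ + log n) + ∑_ℓ [(μ̂_ℓ - μ_ℓ)ᵀ (A_ℓ - B*_ℓ)]²`. -/
noncomputable def errQ (SW : Matrix (Fin p) (Fin p) ℝ) (M : Matrix (Fin p) (Fin L) ℝ) (Δ : ℝ)
    (D : Fin n → Obs p L) (A : Matrix (Fin p) (Fin L) ℝ) : ℝ :=
  frobNorm (CFC.sqrt SW * (A - discB SW M)) ^ 2 * (Δ + Real.log n) +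
    ∑ ℓ : Fin L, (∑ j : Fin p, (meanEst D j ℓ - M j ℓ) * (A j ℓ - discB SW M j ℓ)) ^ 2

/-- The error bounds required of `B̂`: the in-sample prediction error and the `Σ_W`-weighted
Frobenius error are at most `ω₂`, and the `ℓ₁/ℓ₂` error is at most `ω₁`. -/
def ErrorBounds (P : Measure (Obs p L)) (SW : Matrix (Fin p) (Fin p) ℝ) (ω₁ ω₂ : ℝ)
    (D : Fin n → Obs p L) (Bhat : Matrix (Fin p) (Fin L) ℝ) : Prop :=
  max (1 / Real.sqrt n * frobNorm (featMat D * (Bhat - regB P)))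
      (frobNorm (CFC.sqrt SW * (Bhat - regB P))) ≤ ω₂ ∧
    norm12 (Bhat - regB P) ≤ ω₁

end Sample

end LDARegression

open LDARegression

/-! Write D = diag(π), G = Mᵀ Σ_W⁻¹ M and H = (D⁻¹ + G)⁻¹. As Cov(X) = Σ_W + M D Mᵀ and Cov(X, Y) =
M D, one gets Cov(X) B* = M D (D⁻¹ + G), hence B = B* H (`IsLDAModel.regB_eq`), and H = D − Bᵀ
Cov(X) B is the population version of Ĥ. Centring and the Mahalanobis bound keep the entries of G
bounded (`IsLDAModel.abs_gram_le`), so ‖H‖ ≲ 1/L and ‖H⁻¹‖ ≲ L.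

Put E = B̂ − B, Z = Ĥ − H, T = Ĥ⁻¹ and δ = √(L log n / n). Then B̂* − B* = E T − B* Z T
(`plugin_error_eq`). The matrix Z is a diagonal frequency error of norm ≲ δ/L minus a fit
perturbation of Frobenius norm ≲ ω₂/√L + δ/L^{3/2} (`frobNorm_fitPerturbation_le`). Both are small
against 1/L, so Ĥ is invertible with ‖T‖ ≲ L (`isUnit_plugin`). Since ‖Σ_W^{1/2} B*‖_F ≲ √L, the
squared weighted Frobenius error is ≲ L² (ω₂² + log n / n) (`frobNorm_plugin_error_le`).

In the second sum of the error measure, E T is paired with μ̂_ℓ − μ_ℓ by ℓ∞/ℓ₁ duality, which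
produces the ω₁ term. For B* Z T the numbers B*_kᵀ(μ̂_ℓ − μ_ℓ) are ≲ δ, so the ℓ₁ norms of the
columns of Z T have to be bounded. Operator norms are too lossy for the diagonal part of Z; a
self-bounding argument based on T = H⁻¹(H T) replaces them (`sum_abs_weight_perturbation_le`).

All of this is deterministic on a good sample. Chernoff and Bernstein bounds for class frequencies,
for second moments along B* and, in self-normalised form, for class means, with a union bound, show
that a sample fails to be good with probability at most 1/n
(`IsLDAModel.measureReal_not_goodSample_le`). The failure of the assumed error bounds costs another
1/n. -/

namespace LDARegression

/-! ### Frobenius, operator and ℓ₁/ℓ₂ norms of matrices -/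

section MatrixNorms

set_option linter.unusedSectionVars false

open scoped Matrix.Norms.L2Operator

variable {ι κ τ : Type*} [Fintype ι] [Fintype κ] [Fintype τ]

theorem frobNorm_eq_norm (A : Matrix ι κ ℝ) :
    frobNorm A = ‖WithLp.toLp 2 (fun q : ι × κ => A q.1 q.2)‖ := by
  rw [EuclideanSpace.norm_eq, frobNorm, Fintype.sum_prod_type]
  simp

theorem frobNorm_nonneg (A : Matrix ι κ ℝ) : 0 ≤ frobNorm A := Real.sqrt_nonneg _

theorem frobNorm_sq (A : Matrix ι κ ℝ) : frobNorm A ^ 2 = ∑ i, ∑ j, A i j ^ 2 :=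
  Real.sq_sqrt (by positivity)

theorem frobNorm_add_le (A B : Matrix ι κ ℝ) : frobNorm (A + B) ≤ frobNorm A + frobNorm B := by
  simp only [frobNorm_eq_norm]
  exact norm_add_le (WithLp.toLp 2 fun q : ι × κ => A q.1 q.2) (WithLp.toLp 2 fun q => B q.1 q.2)

theorem frobNorm_neg (A : Matrix ι κ ℝ) : frobNorm (-A) = frobNorm A := by
  simp [frobNorm]

theorem frobNorm_sub_le (A B : Matrix ι κ ℝ) : frobNorm (A - B) ≤ frobNorm A + frobNorm B := by
  simpa [sub_eq_add_neg, frobNorm_neg] using frobNorm_add_le A (-B)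

theorem frobNorm_smul (a : ℝ) (A : Matrix ι κ ℝ) : frobNorm (a • A) = |a| * frobNorm A := by
  simp [frobNorm, mul_pow, ← Finset.mul_sum, Real.sqrt_mul (sq_nonneg a), Real.sqrt_sq_eq_abs]

theorem frobNorm_transpose (A : Matrix ι κ ℝ) : frobNorm Aᵀ = frobNorm A := by
  rw [frobNorm, Finset.sum_comm]
  rfl

theorem frobNorm_le_of_abs_le (A : Matrix ι κ ℝ) {a : ℝ} (ha : 0 ≤ a) (h : ∀ i j, |A i j| ≤ a) :
    frobNorm A ≤ a * Real.sqrt (Fintype.card ι * Fintype.card κ) := by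
  refine le_of_sq_le_sq ?_ (by positivity)
  rw [mul_pow, Real.sq_sqrt (by positivity), frobNorm_sq]
  calc ∑ i, ∑ j, A i j ^ 2 ≤ ∑ _i : ι, ∑ _j : κ, a ^ 2 :=
        Finset.sum_le_sum fun i _ => Finset.sum_le_sum fun j _ =>
          sq_le_sq' (abs_le.1 (h i j)).1 (abs_le.1 (h i j)).2
    _ = _ := by simp; ring

/-- Minkowski's inequality for the `ℓ₁` norms of the columns. -/
theorem sum_sq_sum_abs_le_norm12_sq (A : Matrix ι κ ℝ) :
    ∑ j, (∑ i, |A i j|) ^ 2 ≤ norm12 A ^ 2 := by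
  have key : ‖∑ i, (WithLp.toLp 2 (fun j => |A i j|) : EuclideanSpace ℝ κ)‖ ≤ norm12 A := by
    refine (norm_sum_le _ _).trans (le_of_eq ?_)
    refine Finset.sum_congr rfl fun i _ => ?_
    simp [EuclideanSpace.norm_eq]
  refine le_trans (le_of_eq ?_) (pow_le_pow_left₀ (norm_nonneg _) key 2)
  simp [EuclideanSpace.norm_sq_eq]

variable [DecidableEq ι] [DecidableEq κ] [DecidableEq τ]

theorem sum_mulVec_sq_le (A : Matrix ι κ ℝ) (v : κ → ℝ) :
    ∑ i, (A *ᵥ v) i ^ 2 ≤ ‖A‖ ^ 2 * ∑ j, v j ^ 2 := by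
  have h := pow_le_pow_left₀ (norm_nonneg _) (l2_opNorm_mulVec A (WithLp.toLp 2 v)) 2
  rw [mul_pow, EuclideanSpace.norm_sq_eq, EuclideanSpace.norm_sq_eq] at h
  simpa using h

theorem norm_transpose_eq (A : Matrix ι κ ℝ) : ‖Aᵀ‖ = ‖A‖ := by
  rw [← l2_opNorm_conjTranspose A, conjTranspose_eq_transpose_of_trivial]

theorem norm_transpose_mul_self (A : Matrix ι κ ℝ) : ‖Aᵀ * A‖ = ‖A‖ ^ 2 := by
  rw [sq, ← l2_opNorm_conjTranspose_mul_self A, conjTranspose_eq_transpose_of_trivial]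

theorem norm_le_of_sum_mulVec_sq_le (A : Matrix ι κ ℝ) {a : ℝ} (ha : 0 ≤ a)
    (h : ∀ v : κ → ℝ, ∑ i, (A *ᵥ v) i ^ 2 ≤ a ^ 2 * ∑ j, v j ^ 2) : ‖A‖ ≤ a := by
  rw [l2_opNorm_def]
  refine ContinuousLinearMap.opNorm_le_bound _ ha fun v => ?_
  refine le_of_sq_le_sq ?_ (by positivity)
  rw [mul_pow, EuclideanSpace.norm_sq_eq, EuclideanSpace.norm_sq_eq]
  simpa using h v.ofLp

theorem norm_le_frobNorm (A : Matrix ι κ ℝ) : ‖A‖ ≤ frobNorm A := by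
  refine norm_le_of_sum_mulVec_sq_le A (frobNorm_nonneg A) fun v => ?_
  rw [frobNorm_sq, Finset.sum_mul]
  exact Finset.sum_le_sum fun i _ => Finset.sum_mul_sq_le_sq_mul_sq _ _ _

theorem frobNorm_mul_le_left (A : Matrix ι κ ℝ) (B : Matrix κ τ ℝ) :
    frobNorm (A * B) ≤ ‖A‖ * frobNorm B := by
  refine le_of_sq_le_sq ?_ (mul_nonneg (norm_nonneg _) (frobNorm_nonneg _))
  rw [mul_pow, ← frobNorm_transpose B, frobNorm_sq, frobNorm_sq, Finset.sum_comm, Finset.mul_sum]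
  exact Finset.sum_le_sum fun j _ => sum_mulVec_sq_le A (fun i => B i j)

theorem frobNorm_mul_le_right (A : Matrix ι κ ℝ) (B : Matrix κ τ ℝ) :
    frobNorm (A * B) ≤ frobNorm A * ‖B‖ := by
  rw [← frobNorm_transpose, transpose_mul, mul_comm, ← norm_transpose_eq B, ← frobNorm_transpose A]
  exact frobNorm_mul_le_left _ _

/-- Each row of `A * B` is `Bᵀ` applied to a row of `A`. This carries the ℓ₁/ℓ₂ error of the
regression estimate through the multiplication by Ĥ⁻¹. -/
theorem norm12_mul_le (A : Matrix ι κ ℝ) (B : Matrix κ τ ℝ) :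
    norm12 (A * B) ≤ norm12 A * ‖B‖ := by
  rw [norm12, norm12, Finset.sum_mul]
  refine Finset.sum_le_sum fun i _ => ?_
  rw [mul_comm, ← Real.sqrt_sq (norm_nonneg B), ← Real.sqrt_mul (sq_nonneg _)]
  refine Real.sqrt_le_sqrt ?_
  have h := sum_mulVec_sq_le Bᵀ (A i)
  rw [norm_transpose_eq] at h
  refine le_trans (le_of_eq ?_) h
  refine Finset.sum_congr rfl fun j _ => ?_
  simp [mulVec, Matrix.mul_apply, dotProduct, mul_comm]

theorem norm_diagonal_le (d : ι → ℝ) {a : ℝ} (ha : 0 ≤ a) (h : ∀ i, |d i| ≤ a) :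
    ‖(diagonal d : Matrix ι ι ℝ)‖ ≤ a := by
  rw [l2_opNorm_diagonal]
  exact (pi_norm_le_iff_of_nonneg ha).2 h

/-- Coercivity with Cauchy–Schwarz: for `v = J⁻¹ w`, b‖v‖² ≤ ⟨v, w⟩ ≤ ‖v‖ ‖w‖. Symmetry of `J` plays
no role. -/
theorem norm_nonsing_inv_le_of_lower_bound {J : Matrix ι ι ℝ} {b : ℝ} (hb : 0 < b)
    (hJ : IsUnit J) (h : ∀ v : ι → ℝ, b * ∑ i, v i ^ 2 ≤ v ⬝ᵥ (J *ᵥ v)) : ‖J⁻¹‖ ≤ b⁻¹ := by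
  refine norm_le_of_sum_mulVec_sq_le _ (by positivity) fun w => ?_
  set v := J⁻¹ *ᵥ w with hv
  have hw : J *ᵥ v = w := by
    rw [hv, mulVec_mulVec, mul_nonsing_inv _ ((isUnit_iff_isUnit_det _).1 hJ), one_mulVec]
  have h1 := h v
  rw [hw] at h1
  have h2 : (v ⬝ᵥ w) ^ 2 ≤ (∑ i, v i ^ 2) * ∑ i, w i ^ 2 := Finset.sum_mul_sq_le_sq_mul_sq _ _ _
  have hv0 : 0 ≤ ∑ i, v i ^ 2 := by positivity
  rcases hv0.eq_or_lt with h0 | h0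
  · rw [← h0]; positivity
  have h3 : (b * ∑ i, v i ^ 2) ^ 2 ≤ (∑ i, v i ^ 2) * ∑ i, w i ^ 2 :=
    (pow_le_pow_left₀ (by positivity) h1 2).trans h2
  have h4 : b ^ 2 * ∑ i, v i ^ 2 ≤ ∑ i, w i ^ 2 := by
    refine le_of_mul_le_mul_left ?_ h0
    linarith [h3]
  rw [inv_pow, inv_mul_eq_div, le_div_iff₀ (by positivity)]
  linarith

/-- Neumann series: H + Z = H (1 + J Z) with ‖J Z‖ ≤ 1/2. The inverse satisfies T = J − J Z T, so
half of ‖T‖ is absorbed on the left. -/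
theorem isUnit_add_of_norm_le {J H Z : Matrix ι ι ℝ} {a : ℝ} (ha : 0 < a)
    (hJH : J * H = 1) (hJ : ‖J‖ ≤ a) (hZ : ‖Z‖ ≤ 1 / (2 * a)) :
    IsUnit (H + Z) ∧ ‖(H + Z)⁻¹‖ ≤ 2 * a := by
  have hHJ : H * J = 1 := mul_eq_one_comm.1 hJH
  have h1 : ‖J * Z‖ ≤ 1 / 2 := by
    calc ‖J * Z‖ ≤ ‖J‖ * ‖Z‖ := norm_mul_le _ _
      _ ≤ a * (1 / (2 * a)) := by gcongr
      _ = 1 / 2 := by field_simp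
  have hfac : H + Z = H * (1 - -(J * Z)) := by
    rw [mul_sub, mul_neg, ← mul_assoc, hHJ]; simp
  have hunit : IsUnit (H + Z) := by
    rw [hfac]
    refine IsUnit.mul ⟨⟨H, J, hHJ, hJH⟩, rfl⟩ ?_
    refine isUnit_one_sub_of_norm_lt_one ?_
    rw [norm_neg]; linarith
  refine ⟨hunit, ?_⟩
  set T := (H + Z)⁻¹ with hT
  have hTT : (H + Z) * T = 1 := mul_nonsing_inv _ ((isUnit_iff_isUnit_det _).1 hunit)
  have h2 : T = J - J * Z * T := by
    have : J * ((H + Z) * T) = J := by rw [hTT, mul_one]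
    rw [← mul_assoc, mul_add, hJH, add_mul, one_mul] at this
    exact eq_sub_of_add_eq this
  have h3 : ‖T‖ ≤ ‖J‖ + ‖J * Z‖ * ‖T‖ := by
    calc ‖T‖ = ‖J - J * Z * T‖ := by rw [← h2]
      _ ≤ ‖J‖ + ‖J * Z * T‖ := norm_sub_le _ _
      _ ≤ _ := by gcongr; exact norm_mul_le _ _
  nlinarith [norm_nonneg T]

end MatrixNorms

/-! ### Deterministic perturbation of H: invertibility of the plug-in matrix -/

section Perturbation

open scoped Matrix.Norms.L2Operator

/-- The deterministic setting of the plug-in step: `H` is the inverse of `diag(d)⁻¹ + G`, the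
regression matrix is `β * H`, and `d'`, `S`, `E` are the (small) deviations of the empirical class
frequencies, of the sample second moments along `β`, and of the estimated regression matrix. -/
structure PerturbedRegression {n p L : ℕ} (K δ ω : ℝ) (d d' : Fin L → ℝ)
    (G H S : Matrix (Fin L) (Fin L) ℝ) (β E : Matrix (Fin p) (Fin L) ℝ)
    (F : Matrix (Fin n) (Fin p) ℝ) : Prop where
  one_le : 1 ≤ K
  card_pos : 1 ≤ L
  delta_nonneg : 0 ≤ δ
  delta_le : 40 * K ^ 4 * δ ≤ 1
  omega_le : 40 * K ^ 4 * (ω * Real.sqrt L) ≤ 1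
  weight_pos : ∀ ℓ, 0 < d ℓ
  weight_inv_le : ∀ ℓ, (d ℓ)⁻¹ ≤ K * L
  weight_le : ∀ ℓ, d ℓ ≤ K / L
  posSemidef : G.PosSemidef
  gram_le : ∀ k ℓ, |G k ℓ| ≤ K
  inv_mul : (diagonal (fun ℓ => (d ℓ)⁻¹) + G) * H = 1
  second_moment : (F * β)ᵀ * (F * β) =
    G * diagonal d * (diagonal (fun ℓ => (d ℓ)⁻¹) + G) + S
  weight_sub_le : ∀ ℓ, |d' ℓ - d ℓ| ≤ K * δ / L
  moment_le : ∀ k ℓ, |S k ℓ| ≤ K * δ / Real.sqrt L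
  error_le : frobNorm (F * E) ≤ ω

/-- The part of the perturbation of `H` caused by the regression fit. -/
noncomputable def fitPerturbation {n p L : ℕ} (H S : Matrix (Fin L) (Fin L) ℝ)
    (β E : Matrix (Fin p) (Fin L) ℝ) (F : Matrix (Fin n) (Fin p) ℝ) :
    Matrix (Fin L) (Fin L) ℝ :=
  (F * E)ᵀ * (F * E) + (F * E)ᵀ * (F * (β * H)) + (F * (β * H))ᵀ * (F * E) + H * S * H

namespace PerturbedRegression

variable {n p L : ℕ} {K δ ω : ℝ} {d d' : Fin L → ℝ} {G H S : Matrix (Fin L) (Fin L) ℝ}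
  {β E : Matrix (Fin p) (Fin L) ℝ} {F : Matrix (Fin n) (Fin p) ℝ}

theorem K_pos (h : PerturbedRegression K δ ω d d' G H S β E F) : 0 < K :=
  lt_of_lt_of_le one_pos h.one_le

theorem one_le_card (h : PerturbedRegression K δ ω d d' G H S β E F) : (1 : ℝ) ≤ L := by
  exact_mod_cast h.card_pos

theorem one_le_sqrt (h : PerturbedRegression K δ ω d d' G H S β E F) : 1 ≤ Real.sqrt L :=
  Real.one_le_sqrt.2 h.one_le_card

theorem omega_nonneg (h : PerturbedRegression K δ ω d d' G H S β E F) : 0 ≤ ω :=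
  (frobNorm_nonneg _).trans h.error_le

theorem mul_inv (h : PerturbedRegression K δ ω d d' G H S β E F) :
    H * (diagonal (fun ℓ => (d ℓ)⁻¹) + G) = 1 :=
  mul_eq_one_comm.1 h.inv_mul

theorem inv_eq (h : PerturbedRegression K δ ω d d' G H S β E F) :
    (diagonal (fun ℓ => (d ℓ)⁻¹) + G)⁻¹ = H :=
  inv_eq_right_inv h.inv_mul

theorem gram_transpose (h : PerturbedRegression K δ ω d d' G H S β E F) : Gᵀ = G := by
  rw [← conjTranspose_eq_transpose_of_trivial]
  exact h.posSemidef.isHermitian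

theorem transpose_eq (h : PerturbedRegression K δ ω d d' G H S β E F) : Hᵀ = H := by
  rw [← h.inv_eq, transpose_nonsing_inv, transpose_add, diagonal_transpose, h.gram_transpose]

theorem norm_gram_le (h : PerturbedRegression K δ ω d d' G H S β E F) : ‖G‖ ≤ K * L := by
  refine (norm_le_frobNorm G).trans ((frobNorm_le_of_abs_le G h.K_pos.le h.gram_le).trans ?_)
  simp

theorem norm_inv_le (h : PerturbedRegression K δ ω d d' G H S β E F) :
    ‖diagonal (fun ℓ => (d ℓ)⁻¹) + G‖ ≤ 2 * K * L := by
  have hK := h.K_pos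
  have h1 : ‖(diagonal (fun ℓ => (d ℓ)⁻¹) : Matrix (Fin L) (Fin L) ℝ)‖ ≤ K * L :=
    norm_diagonal_le _ (by positivity) fun ℓ => by
      rw [abs_of_pos (inv_pos.2 (h.weight_pos ℓ))]; exact h.weight_inv_le ℓ
  linarith [norm_add_le (diagonal (fun ℓ => (d ℓ)⁻¹) : Matrix (Fin L) (Fin L) ℝ) G,
    h.norm_gram_le]

/-- Adding the positive semidefinite `G` can only increase the quadratic form, which is already at
least L/K times the squared norm because of the diagonal part. -/
theorem norm_le (h : PerturbedRegression K δ ω d d' G H S β E F) : ‖H‖ ≤ K / L := by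
  have hK := h.K_pos
  have hL := h.one_le_card
  have hb : (0 : ℝ) < L / K := by positivity
  have := norm_nonsing_inv_le_of_lower_bound (J := diagonal (fun ℓ => (d ℓ)⁻¹) + G) hb
    ⟨⟨_, H, h.inv_mul, h.mul_inv⟩, rfl⟩ ?_
  · rwa [h.inv_eq, inv_div] at this
  intro v
  rw [add_mulVec, dotProduct_add]
  have h1 : 0 ≤ v ⬝ᵥ (G *ᵥ v) := by
    simpa using h.posSemidef.dotProduct_mulVec_nonneg v
  have h2 : v ⬝ᵥ ((diagonal fun ℓ => (d ℓ)⁻¹) *ᵥ v) = ∑ i, (d i)⁻¹ * v i ^ 2 := by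
    simp only [dotProduct, mulVec_diagonal]
    exact Finset.sum_congr rfl fun i _ => by ring
  have h3 : L / K * ∑ i, v i ^ 2 ≤ ∑ i, (d i)⁻¹ * v i ^ 2 := by
    rw [Finset.mul_sum]
    refine Finset.sum_le_sum fun i _ => mul_le_mul_of_nonneg_right ?_ (sq_nonneg _)
    rw [← inv_div]
    exact inv_anti₀ (h.weight_pos i) (h.weight_le i)
  linarith

theorem frobNorm_moment_le (h : PerturbedRegression K δ ω d d' G H S β E F) :
    frobNorm S ≤ K * δ * Real.sqrt L := by
  have hK := h.K_pos
  have hδ := h.delta_nonneg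
  have hr : 0 < Real.sqrt L := lt_of_lt_of_le one_pos h.one_le_sqrt
  refine (frobNorm_le_of_abs_le S (by positivity) h.moment_le).trans (le_of_eq ?_)
  rw [Fintype.card_fin, Real.sqrt_mul_self (by positivity), div_mul_eq_mul_div,
    div_eq_iff hr.ne', mul_assoc (K * δ), Real.mul_self_sqrt (by positivity)]

theorem frobNorm_moment_sandwich_le (h : PerturbedRegression K δ ω d d' G H S β E F) :
    frobNorm (H * S * H) ≤ K ^ 3 * δ / (L * Real.sqrt L) := by
  have hK := h.K_pos
  have hL := h.one_le_card
  have hr : 0 < Real.sqrt L := lt_of_lt_of_le one_pos h.one_le_sqrt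
  have hrr : Real.sqrt L * Real.sqrt L = L := Real.mul_self_sqrt (by positivity)
  calc frobNorm (H * S * H) ≤ ‖H‖ * frobNorm S * ‖H‖ :=
        (frobNorm_mul_le_right _ _).trans
          (mul_le_mul_of_nonneg_right (frobNorm_mul_le_left _ _) (norm_nonneg _))
    _ ≤ K / L * (K * δ * Real.sqrt L) * (K / L) := by
        have := frobNorm_nonneg S
        have hδ := h.delta_nonneg
        exact mul_le_mul (mul_le_mul h.norm_le h.frobNorm_moment_le this (by positivity)) h.norm_le
          (norm_nonneg _) (by positivity)
    _ = K ^ 3 * δ / (L * Real.sqrt L) := by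
        rw [eq_div_iff (by positivity)]
        field_simp
        rw [sq, hrr, mul_comm]

/-- Sample counterpart of Bᵀ Cov(X) B = D − H: from H (D⁻¹ + G) = 1 follows H G D = D − H, and the
sampling error `S` survives only between two factors of size 1/L. -/
theorem second_moment_fit (h : PerturbedRegression K δ ω d d' G H S β E F) :
    (F * (β * H))ᵀ * (F * (β * H)) = diagonal d - H + H * S * H := by
  have hd : diagonal (fun ℓ => (d ℓ)⁻¹) * diagonal d = 1 := by
    rw [diagonal_mul_diagonal, ← diagonal_one]
    exact congrArg _ (funext fun ℓ => inv_mul_cancel₀ (h.weight_pos ℓ).ne')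
  have hG : H * G * diagonal d = diagonal d - H := by
    have h1 : H * G = 1 - H * diagonal (fun ℓ => (d ℓ)⁻¹) := by
      rw [eq_sub_iff_add_eq, add_comm, ← mul_add, h.mul_inv]
    rw [h1, sub_mul, one_mul, Matrix.mul_assoc, hd, mul_one]
  calc (F * (β * H))ᵀ * (F * (β * H)) = Hᵀ * ((F * β)ᵀ * (F * β)) * H := by
        simp only [transpose_mul, Matrix.mul_assoc]
    _ = H * (G * diagonal d * (diagonal (fun ℓ => (d ℓ)⁻¹) + G) + S) * H := by
        rw [h.second_moment, h.transpose_eq]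
    _ = H * G * diagonal d * ((diagonal (fun ℓ => (d ℓ)⁻¹) + G) * H) + H * S * H := by
        simp only [mul_add, add_mul, Matrix.mul_assoc]
    _ = diagonal d - H + H * S * H := by rw [h.inv_mul, mul_one, hG]

/-- The squared norm is that of the Gram matrix, whose three terms in the preceding identity are
each at most K/L; then 3K ≤ (2K)². The resulting factor 1/√L is what makes the cross terms with `F *
E` of order ω/√L. -/
theorem norm_fit_le (h : PerturbedRegression K δ ω d d' G H S β E F) :
    ‖F * (β * H)‖ ≤ 2 * K / Real.sqrt L := by
  have hK := h.K_pos
  have hK1 := h.one_le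
  have hL := h.one_le_card
  have hr1 := h.one_le_sqrt
  have hδ := h.delta_nonneg
  have hr : 0 < Real.sqrt L := lt_of_lt_of_le one_pos hr1
  refine le_of_sq_le_sq ?_ (by positivity)
  rw [← norm_transpose_mul_self, h.second_moment_fit, div_pow, Real.sq_sqrt (by positivity)]
  have h1 : ‖(diagonal d : Matrix (Fin L) (Fin L) ℝ)‖ ≤ K / L :=
    norm_diagonal_le _ (by positivity) fun ℓ => by
      rw [abs_of_pos (h.weight_pos ℓ)]; exact h.weight_le ℓ
  have h2 : ‖H * S * H‖ ≤ K / L := by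
    refine (norm_le_frobNorm _).trans (h.frobNorm_moment_sandwich_le.trans ?_)
    rw [← div_div]
    have h3 : K ^ 3 * δ / L ≤ 1 / L := by
      gcongr
      nlinarith [h.delta_le, mul_nonneg (pow_pos hK 3).le hδ]
    calc K ^ 3 * δ / L / Real.sqrt L ≤ K ^ 3 * δ / L := div_le_self (by positivity) hr1
      _ ≤ 1 / L := h3
      _ ≤ K / L := by gcongr
  calc ‖diagonal d - H + H * S * H‖ ≤ ‖diagonal d - H‖ + ‖H * S * H‖ := norm_add_le _ _
    _ ≤ ‖diagonal d‖ + ‖H‖ + ‖H * S * H‖ := by gcongr; exact norm_sub_le _ _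
    _ ≤ K / L + K / L + K / L := by gcongr; exact h.norm_le
    _ = 3 * K / L := by ring
    _ ≤ (2 * K) ^ 2 / L := by gcongr; nlinarith

theorem frobNorm_fitPerturbation_le (h : PerturbedRegression K δ ω d d' G H S β E F) :
    frobNorm (fitPerturbation H S β E F) ≤
      5 * K * ω / Real.sqrt L + K ^ 3 * δ / (L * Real.sqrt L) := by
  have hK := h.K_pos
  have hK1 := h.one_le
  have hω := h.omega_nonneg
  have hr : 0 < Real.sqrt L := lt_of_lt_of_le one_pos h.one_le_sqrt
  have hE : ‖F * E‖ ≤ ω := (norm_le_frobNorm _).trans h.error_le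
  have hEt : frobNorm (F * E)ᵀ ≤ ω := by rw [frobNorm_transpose]; exact h.error_le
  have h1 : frobNorm ((F * E)ᵀ * (F * E)) ≤ ω * ω :=
    (frobNorm_mul_le_right _ _).trans (mul_le_mul hEt hE (norm_nonneg _) hω)
  have h2 : frobNorm ((F * E)ᵀ * (F * (β * H))) ≤ ω * (2 * K / Real.sqrt L) :=
    (frobNorm_mul_le_right _ _).trans (mul_le_mul hEt h.norm_fit_le (norm_nonneg _) hω)
  have h3 : frobNorm ((F * (β * H))ᵀ * (F * E)) ≤ ω * (2 * K / Real.sqrt L) := by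
    rw [← frobNorm_transpose, transpose_mul, transpose_transpose]
    exact h2
  -- The smallness of ω√L reduces the quadratic term to the order of the cross terms.
  have h4 : ω * ω ≤ K * ω / Real.sqrt L := by
    rw [le_div_iff₀ hr]
    have : 0 ≤ ω * Real.sqrt L := by positivity
    have h5 : ω * Real.sqrt L ≤ K := by
      have : 1 ≤ K ^ 4 := one_le_pow₀ hK1
      nlinarith [h.omega_le]
    nlinarith
  have e1 := frobNorm_add_le ((F * E)ᵀ * (F * E)) ((F * E)ᵀ * (F * (β * H)))
  have e2 := frobNorm_add_le ((F * E)ᵀ * (F * E) + (F * E)ᵀ * (F * (β * H)))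
    ((F * (β * H))ᵀ * (F * E))
  have e3 := frobNorm_add_le ((F * E)ᵀ * (F * E) + (F * E)ᵀ * (F * (β * H)) +
    (F * (β * H))ᵀ * (F * E)) (H * S * H)
  have h6 := h.frobNorm_moment_sandwich_le
  have h7 : ω * (2 * K / Real.sqrt L) = 2 * (K * ω / Real.sqrt L) := by ring
  have h8 : 5 * K * ω / Real.sqrt L = 5 * (K * ω / Real.sqrt L) := by ring
  rw [fitPerturbation]
  linarith

theorem plugin_eq (h : PerturbedRegression K δ ω d d' G H S β E F) :
    diagonal d' - (F * (β * H + E))ᵀ * (F * (β * H + E)) =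
      H + (diagonal (fun ℓ => d' ℓ - d ℓ) - fitPerturbation H S β E F) := by
  have h1 : (F * (β * H + E))ᵀ * (F * (β * H + E)) = (F * (β * H))ᵀ * (F * (β * H)) +
      ((F * E)ᵀ * (F * E) + (F * E)ᵀ * (F * (β * H)) + (F * (β * H))ᵀ * (F * E)) := by
    rw [Matrix.mul_add, transpose_add, Matrix.mul_add, Matrix.add_mul, Matrix.add_mul]; abel
  have h2 : (diagonal (fun ℓ => d' ℓ - d ℓ) : Matrix (Fin L) (Fin L) ℝ) =
      diagonal d' - diagonal d := (diagonal_sub d' d).symm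
  rw [h1, h.second_moment_fit, fitPerturbation, h2]
  abel

theorem isUnit_plugin (h : PerturbedRegression K δ ω d d' G H S β E F) :
    IsUnit (diagonal d' - (F * (β * H + E))ᵀ * (F * (β * H + E))) ∧
      ‖(diagonal d' - (F * (β * H + E))ᵀ * (F * (β * H + E)))⁻¹‖ ≤ 4 * K * L := by
  have hK := h.K_pos
  have hK1 := h.one_le
  have hL := h.one_le_card
  have hL0 : (0 : ℝ) < L := by linarith
  have hδ := h.delta_nonneg
  have hω := h.omega_nonneg
  have hr1 := h.one_le_sqrt
  have hr : 0 < Real.sqrt L := lt_of_lt_of_le one_pos hr1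
  have hrr : Real.sqrt L * Real.sqrt L = L := Real.mul_self_sqrt (by positivity)
  have h1 : ‖(diagonal (fun ℓ => d' ℓ - d ℓ) : Matrix (Fin L) (Fin L) ℝ)‖ ≤ K * δ / L :=
    norm_diagonal_le _ (by positivity) h.weight_sub_le
  have h2 := (norm_le_frobNorm _).trans h.frobNorm_fitPerturbation_le
  have h3 : 5 * K * ω / Real.sqrt L = 5 * K * (ω * Real.sqrt L) / L := by
    rw [div_eq_div_iff hr.ne' hL0.ne']
    linear_combination (-(5 * K * ω)) * hrr
  have h4 : K ^ 3 * δ / (L * Real.sqrt L) ≤ K ^ 3 * δ / L := by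
    gcongr; nlinarith
  have key : ‖diagonal (fun ℓ => d' ℓ - d ℓ) - fitPerturbation H S β E F‖ ≤
      1 / (2 * (2 * K * L)) := by
    -- Multiplied by 4K, the left side is at most 8 K⁴ δ + 20 K⁴ ω√L ≤ 8/40 + 20/40; the factor 40
    -- K⁴ in the smallness conditions leaves room here.
    have hsum : K * δ + 5 * K * (ω * Real.sqrt L) + K ^ 3 * δ ≤ 1 / (4 * K) := by
      rw [le_div_iff₀ (by positivity)]
      have hx : 0 ≤ ω * Real.sqrt L := by positivity
      have hK2 : K ^ 2 ≤ K ^ 4 := pow_le_pow_right₀ hK1 (by norm_num)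
      have a1 : K ^ 2 * δ ≤ K ^ 4 * δ := by gcongr
      have a2 : K ^ 2 * (ω * Real.sqrt L) ≤ K ^ 4 * (ω * Real.sqrt L) := by gcongr
      have := h.delta_le
      have := h.omega_le
      nlinarith
    calc _ ≤ ‖(diagonal (fun ℓ => d' ℓ - d ℓ) : Matrix (Fin L) (Fin L) ℝ)‖ +
          ‖fitPerturbation H S β E F‖ := norm_sub_le _ _
      _ ≤ K * δ / L + (5 * K * (ω * Real.sqrt L) / L + K ^ 3 * δ / L) := by linarith
      _ = (K * δ + 5 * K * (ω * Real.sqrt L) + K ^ 3 * δ) / L := by ring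
      _ ≤ 1 / (4 * K) / L := by gcongr
      _ = 1 / (2 * (2 * K * L)) := by rw [div_div]; ring
  have := isUnit_add_of_norm_le (by positivity) h.inv_mul h.norm_inv_le key
  rw [h.plugin_eq]
  refine ⟨this.1, this.2.trans (le_of_eq (by ring))⟩

end PerturbedRegression

end Perturbation

/-! ### Deterministic bounds on the plug-in error -/

section PluginError

open scoped Matrix.Norms.L2Operator

namespace PerturbedRegression

variable {n p L : ℕ} {K δ ω : ℝ} {d d' : Fin L → ℝ} {G H S T : Matrix (Fin L) (Fin L) ℝ}
  {β E : Matrix (Fin p) (Fin L) ℝ} {F : Matrix (Fin n) (Fin p) ℝ}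

/-- Substituting β = β (H + Z) T cancels the main term β H T. -/
theorem plugin_error_eq (h : PerturbedRegression K δ ω d d' G H S β E F)
    (hT : (diagonal d' - (F * (β * H + E))ᵀ * (F * (β * H + E))) * T = 1) :
    (β * H + E) * T - β =
      E * T - β * ((diagonal (fun ℓ => d' ℓ - d ℓ) - fitPerturbation H S β E F) * T) := by
  rw [h.plugin_eq, add_mul] at hT
  have h1 : (diagonal (fun ℓ => d' ℓ - d ℓ) - fitPerturbation H S β E F) * T = 1 - H * T :=
    eq_sub_of_add_eq' hT
  rw [h1, Matrix.mul_sub, Matrix.mul_one, Matrix.add_mul, Matrix.mul_assoc]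
  abel

/-- Here `A` plays the role of Σ_W^{1/2}. The factor ‖A β‖_F ≲ √L meets ‖Z‖ ≲ δ/L + ω/√L, so A β Z
is of the same order as A E up to δ/√L; multiplication by `T` costs L. -/
theorem frobNorm_plugin_error_le (h : PerturbedRegression K δ ω d d' G H S β E F)
    (hT : (diagonal d' - (F * (β * H + E))ᵀ * (F * (β * H + E))) * T = 1)
    (hT' : ‖T‖ ≤ 4 * K * L) {q : ℕ} (A : Matrix (Fin q) (Fin p) ℝ)
    (hA : (A * β)ᵀ * (A * β) = G) (hE : frobNorm (A * E) ≤ ω) :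
    frobNorm (A * ((β * H + E) * T - β)) ≤ 24 * K ^ 5 * L * (ω + δ / Real.sqrt L) := by
  have hK := h.K_pos
  have hK1 := h.one_le
  have hL := h.one_le_card
  have hδ := h.delta_nonneg
  have hω := h.omega_nonneg
  have hr1 := h.one_le_sqrt
  have hr : 0 < Real.sqrt L := lt_of_lt_of_le one_pos hr1
  have hrr : Real.sqrt L * Real.sqrt L = L := Real.mul_self_sqrt (by positivity)
  set Z := diagonal (fun ℓ => d' ℓ - d ℓ) - fitPerturbation H S β E F with hZ
  -- The squared Frobenius norm is the trace of `G`.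
  have hAβ : frobNorm (A * β) ≤ K * Real.sqrt L := by
    refine le_of_sq_le_sq ?_ (by positivity)
    rw [frobNorm_sq, Finset.sum_comm, mul_pow, sq (Real.sqrt _), hrr]
    calc ∑ ℓ, ∑ i, (A * β) i ℓ ^ 2 = ∑ ℓ, G ℓ ℓ := by
          refine Finset.sum_congr rfl fun ℓ _ => ?_
          rw [← hA, Matrix.mul_apply]
          exact Finset.sum_congr rfl fun i _ => by rw [transpose_apply, sq]
      _ ≤ ∑ _ℓ : Fin L, K := Finset.sum_le_sum fun ℓ _ => (le_abs_self _).trans (h.gram_le ℓ ℓ)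
      _ = K * L := by simp [mul_comm]
      _ ≤ K ^ 2 * L := by gcongr; nlinarith
  have hZn : ‖Z‖ ≤ K * δ / L + (5 * K * ω / Real.sqrt L + K ^ 3 * δ / (L * Real.sqrt L)) :=
    (norm_sub_le _ _).trans (add_le_add (norm_diagonal_le _ (by positivity) h.weight_sub_le)
      ((norm_le_frobNorm _).trans h.frobNorm_fitPerturbation_le))
  have hZ2 : K * Real.sqrt L *
      (K * δ / L + (5 * K * ω / Real.sqrt L + K ^ 3 * δ / (L * Real.sqrt L))) ≤
      5 * K ^ 2 * ω + 2 * K ^ 4 * (δ / Real.sqrt L) := by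
    have e1 : K * Real.sqrt L *
      (K * δ / L + (5 * K * ω / Real.sqrt L + K ^ 3 * δ / (L * Real.sqrt L))) =
      5 * K ^ 2 * ω + K ^ 2 * (δ / Real.sqrt L) + K ^ 4 * (δ / L) := by
      -- Stated for a generic r with l = r², so that the identity is rational in r = √L.
      have : ∀ r l : ℝ, 0 < r → r * r = l →
          K * r * (K * δ / l + (5 * K * ω / r + K ^ 3 * δ / (l * r))) =
            5 * K ^ 2 * ω + K ^ 2 * (δ / r) + K ^ 4 * (δ / l) := by
        rintro r l h0 rfl
        field_simp
        ring
      exact this _ _ hr hrr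
    have e2 : δ / L ≤ δ / Real.sqrt L := by
      gcongr; nlinarith
    have e3 : K ^ 2 * (δ / Real.sqrt L) ≤ K ^ 4 * (δ / Real.sqrt L) := by
      gcongr <;> first | exact hK1 | norm_num
    have e4 : K ^ 4 * (δ / L) ≤ K ^ 4 * (δ / Real.sqrt L) := by gcongr
    linarith
  have e1 : A * ((β * H + E) * T - β) = (A * E - A * β * Z) * T := by
    rw [h.plugin_error_eq hT, ← hZ, Matrix.mul_sub, Matrix.sub_mul (A * E)]
    simp only [Matrix.mul_assoc]
  have e2 : frobNorm (A * E - A * β * Z) ≤ 6 * K ^ 4 * (ω + δ / Real.sqrt L) := by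
    have a1 := frobNorm_sub_le (A * E) (A * β * Z)
    have a2 : frobNorm (A * β * Z) ≤ 5 * K ^ 2 * ω + 2 * K ^ 4 * (δ / Real.sqrt L) :=
      (frobNorm_mul_le_right _ _).trans
        ((mul_le_mul hAβ hZn (norm_nonneg _) (by positivity)).trans hZ2)
    have a3 : K ^ 2 * ω ≤ K ^ 4 * ω := by
      gcongr <;> first | exact hK1 | norm_num
    have a4 : ω ≤ K ^ 4 * ω := le_mul_of_one_le_left hω (one_le_pow₀ hK1)
    have a5 : 0 ≤ K ^ 4 * (δ / Real.sqrt L) := by positivity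
    linarith
  rw [e1]
  calc _ ≤ 6 * K ^ 4 * (ω + δ / Real.sqrt L) * (4 * K * L) :=
        (frobNorm_mul_le_right _ _).trans (mul_le_mul e2 hT' (norm_nonneg _) (by positivity))
    _ = _ := by ring

/-- Bounding the diagonal part by operator norms and Cauchy–Schwarz would require δ²L to be bounded,
which is not assumed. Instead, with V = H T one has T = (D⁻¹ + G) V, so the small diagonal entries
act on V in ℓ₁ with total factor 2K²δ ≤ 1/2; and V = 1 − Z₁T + Z₂T. The unknown sum thus reappears
with coefficient at most 1/2 and is absorbed. -/
theorem sum_abs_weight_perturbation_le (h : PerturbedRegression K δ ω d d' G H S β E F)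
    (hT : (diagonal d' - (F * (β * H + E))ᵀ * (F * (β * H + E))) * T = 1) (ℓ : Fin L) :
    ∑ k, |(diagonal (fun ℓ => d' ℓ - d ℓ) * T) k ℓ| ≤
      1 + ∑ k, |(fitPerturbation H S β E F * T) k ℓ| := by
  have hK := h.K_pos
  have hK1 := h.one_le
  have hL := h.one_le_card
  have hL0 : (0 : ℝ) < L := by linarith
  have hδ := h.delta_nonneg
  set Z₁ : Matrix (Fin L) (Fin L) ℝ := diagonal (fun ℓ => d' ℓ - d ℓ) with hZ₁
  set Z₂ := fitPerturbation H S β E F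
  set V := H * T with hV
  have hV1 : V = 1 - Z₁ * T + Z₂ * T := by
    rw [h.plugin_eq, add_mul, sub_mul] at hT
    rw [hV, ← hT]; abel
  have hTV : T = (diagonal (fun ℓ => (d ℓ)⁻¹) + G) * V := by
    rw [hV, ← Matrix.mul_assoc, h.inv_mul, one_mul]
  have hVsum : ∑ k, |V k ℓ| ≤ 1 + ∑ k, |(Z₁ * T) k ℓ| + ∑ k, |(Z₂ * T) k ℓ| := by
    have hone : ∑ k, |(1 : Matrix (Fin L) (Fin L) ℝ) k ℓ| = 1 := by
      simp [Matrix.one_apply, apply_ite abs]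
    rw [← hone, ← Finset.sum_add_distrib, ← Finset.sum_add_distrib]
    refine Finset.sum_le_sum fun k _ => ?_
    rw [hV1, Matrix.add_apply, Matrix.sub_apply]
    exact (abs_add_le _ _).trans (add_le_add_left (abs_sub _ _) _)
  have hentry : ∀ k, |(Z₁ * T) k ℓ| ≤
      K * δ / L * (K * L * |V k ℓ| + K * ∑ j, |V j ℓ|) := by
    intro k
    rw [hZ₁, diagonal_mul, abs_mul]
    refine mul_le_mul (h.weight_sub_le k) ?_ (abs_nonneg _) (by positivity)
    have : T k ℓ = (d k)⁻¹ * V k ℓ + ∑ j, G k j * V j ℓ := by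
      conv_lhs => rw [hTV, Matrix.add_mul, Matrix.add_apply, diagonal_mul, Matrix.mul_apply]
    rw [this]
    refine (abs_add_le _ _).trans (add_le_add ?_ ?_)
    · rw [abs_mul, abs_of_pos (inv_pos.2 (h.weight_pos k))]
      exact mul_le_mul_of_nonneg_right (h.weight_inv_le k) (abs_nonneg _)
    · rw [Finset.mul_sum]
      refine (Finset.abs_sum_le_sum_abs _ _).trans (Finset.sum_le_sum fun j _ => ?_)
      rw [abs_mul]
      exact mul_le_mul_of_nonneg_right (h.gram_le k j) (abs_nonneg _)
  have hsum : ∑ k, |(Z₁ * T) k ℓ| ≤ 2 * K ^ 2 * δ * ∑ k, |V k ℓ| := by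
    calc ∑ k, |(Z₁ * T) k ℓ| ≤ ∑ k, K * δ / L * (K * L * |V k ℓ| + K * ∑ j, |V j ℓ|) :=
          Finset.sum_le_sum fun k _ => hentry k
      _ = K * δ / L * (K * L * ∑ k, |V k ℓ| + L * (K * ∑ j, |V j ℓ|)) := by
          rw [← Finset.mul_sum, Finset.sum_add_distrib, ← Finset.mul_sum, Finset.sum_const]
          simp
      _ = _ := by field_simp; ring
  have hsmall : 2 * K ^ 2 * δ ≤ 1 / 2 := by
    have : K ^ 2 * δ ≤ K ^ 4 * δ := by gcongr <;> first | exact hK1 | norm_num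
    linarith [h.delta_le]
  have hV0 : 0 ≤ ∑ k, |V k ℓ| := Finset.sum_nonneg fun _ _ => abs_nonneg _
  nlinarith

theorem frobNorm_fitPerturbation_mul_le (h : PerturbedRegression K δ ω d d' G H S β E F)
    (hT' : ‖T‖ ≤ 4 * K * L) : frobNorm (fitPerturbation H S β E F * T) ≤ 1 := by
  have hK := h.K_pos
  have hK1 := h.one_le
  have hL := h.one_le_card
  have hL0 : (0 : ℝ) < L := by linarith
  have hδ := h.delta_nonneg
  have hω := h.omega_nonneg
  have hr1 := h.one_le_sqrt
  have hr : 0 < Real.sqrt L := lt_of_lt_of_le one_pos hr1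
  have hrr : Real.sqrt L * Real.sqrt L = L := Real.mul_self_sqrt (by positivity)
  have e0 : (5 * K * ω / Real.sqrt L + K ^ 3 * δ / (L * Real.sqrt L)) * (4 * K * L) =
      20 * K ^ 2 * (ω * Real.sqrt L) + 4 * (K ^ 4 * δ) / Real.sqrt L := by
    have : ∀ r l : ℝ, 0 < r → r * r = l →
        (5 * K * ω / r + K ^ 3 * δ / (l * r)) * (4 * K * l) =
          20 * K ^ 2 * (ω * r) + 4 * (K ^ 4 * δ) / r := by
      rintro r l h0 rfl
      field_simp
      ring
    exact this _ _ hr hrr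
  have e1 : 4 * (K ^ 4 * δ) / Real.sqrt L ≤ 4 * (K ^ 4 * δ) := div_le_self (by positivity) hr1
  have e2 : K ^ 2 * (ω * Real.sqrt L) ≤ K ^ 4 * (ω * Real.sqrt L) := by
    gcongr <;> first | exact hK1 | norm_num
  have e3 := (frobNorm_mul_le_right (fitPerturbation H S β E F) T).trans
    (mul_le_mul h.frobNorm_fitPerturbation_le hT' (norm_nonneg _) (by positivity))
  rw [e0] at e3
  linarith [h.delta_le, h.omega_le]

/-- The matrix `R` stands for M̂ − M. The contribution of E T uses only the entrywise size ρ of `R`,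
by ℓ∞/ℓ₁ duality and Minkowski's inequality. The contribution of β Z T uses the projections of `R`
on the columns of β, whose bound K δ does not involve the dimension p. -/
theorem sum_mean_error_le (h : PerturbedRegression K δ ω d d' G H S β E F)
    (hT : (diagonal d' - (F * (β * H + E))ᵀ * (F * (β * H + E))) * T = 1)
    (hT' : ‖T‖ ≤ 4 * K * L) (R : Matrix (Fin p) (Fin L) ℝ) {ρ ω₁ : ℝ}
    (hR : ∀ j ℓ, |R j ℓ| ≤ ρ) (hE : norm12 E ≤ ω₁)
    (hβR : ∀ k ℓ, |∑ j, β j k * R j ℓ| ≤ K * δ) :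
    ∑ ℓ, (∑ j, R j ℓ * ((β * H + E) * T - β) j ℓ) ^ 2 ≤
      32 * K ^ 2 * (ρ ^ 2 * ω₁ ^ 2 * (L : ℝ) ^ 2) + 20 * K ^ 2 * (δ ^ 2 * L) := by
  have hK := h.K_pos
  have hδ := h.delta_nonneg
  set Z₁ : Matrix (Fin L) (Fin L) ℝ := diagonal (fun ℓ => d' ℓ - d ℓ) with hZ₁
  set Z₂ := fitPerturbation H S β E F with hZ₂
  have hsplit : ∀ ℓ, ∑ j, R j ℓ * ((β * H + E) * T - β) j ℓ =
      ∑ j, R j ℓ * (E * T) j ℓ - ∑ k, (∑ j, β j k * R j ℓ) * ((Z₁ - Z₂) * T) k ℓ := by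
    intro ℓ
    rw [h.plugin_error_eq hT, ← hZ₁, ← hZ₂]
    generalize (Z₁ - Z₂) * T = W
    simp only [Matrix.sub_apply, mul_sub, Finset.sum_sub_distrib]
    congr 1
    simp only [Matrix.mul_apply, Finset.mul_sum, Finset.sum_mul]
    rw [Finset.sum_comm]
    exact Finset.sum_congr rfl fun k _ => Finset.sum_congr rfl fun j _ => by ring
  have hfirst : ∑ ℓ, (∑ j, R j ℓ * (E * T) j ℓ) ^ 2 ≤
      16 * K ^ 2 * (ρ ^ 2 * ω₁ ^ 2 * (L : ℝ) ^ 2) := by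
    have h1 : ∀ ℓ, (∑ j, R j ℓ * (E * T) j ℓ) ^ 2 ≤ ρ ^ 2 * (∑ j, |(E * T) j ℓ|) ^ 2 := by
      intro ℓ
      rw [← mul_pow, ← sq_abs]
      refine pow_le_pow_left₀ (abs_nonneg _) ?_ 2
      rw [Finset.mul_sum]
      refine (Finset.abs_sum_le_sum_abs _ _).trans (Finset.sum_le_sum fun j _ => ?_)
      rw [abs_mul]
      exact mul_le_mul_of_nonneg_right (hR j ℓ) (abs_nonneg _)
    have h0 : 0 ≤ norm12 E := Finset.sum_nonneg fun _ _ => Real.sqrt_nonneg _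
    have h0' : 0 ≤ norm12 (E * T) := Finset.sum_nonneg fun _ _ => Real.sqrt_nonneg _
    have h2 : norm12 (E * T) ≤ ω₁ * (4 * K * L) :=
      (norm12_mul_le E T).trans (mul_le_mul hE hT' (norm_nonneg _) (h0.trans hE))
    calc _ ≤ ∑ ℓ, ρ ^ 2 * (∑ j, |(E * T) j ℓ|) ^ 2 := Finset.sum_le_sum fun ℓ _ => h1 ℓ
      _ ≤ ρ ^ 2 * norm12 (E * T) ^ 2 := by
          rw [← Finset.mul_sum]
          exact mul_le_mul_of_nonneg_left (sum_sq_sum_abs_le_norm12_sq _) (sq_nonneg _)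
      _ ≤ ρ ^ 2 * (ω₁ * (4 * K * L)) ^ 2 := by gcongr
      _ = _ := by ring
  have hsecond : ∑ ℓ, (∑ k, (∑ j, β j k * R j ℓ) * ((Z₁ - Z₂) * T) k ℓ) ^ 2 ≤
      10 * K ^ 2 * (δ ^ 2 * L) := by
    have h1 : ∀ ℓ, (∑ k, (∑ j, β j k * R j ℓ) * ((Z₁ - Z₂) * T) k ℓ) ^ 2 ≤
        (K * δ) ^ 2 * (2 + 8 * (L * ∑ k, (Z₂ * T) k ℓ ^ 2)) := by
      intro ℓ
      have a1 : |∑ k, (∑ j, β j k * R j ℓ) * ((Z₁ - Z₂) * T) k ℓ| ≤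
          K * δ * (1 + 2 * ∑ k, |(Z₂ * T) k ℓ|) := by
        have a2 := h.sum_abs_weight_perturbation_le hT ℓ
        rw [← hZ₁, ← hZ₂] at a2
        calc _ ≤ ∑ k, K * δ * (|(Z₁ * T) k ℓ| + |(Z₂ * T) k ℓ|) := by
              refine (Finset.abs_sum_le_sum_abs _ _).trans (Finset.sum_le_sum fun k _ => ?_)
              rw [abs_mul, sub_mul, Matrix.sub_apply]
              exact mul_le_mul (hβR k ℓ) (abs_sub _ _) (abs_nonneg _) (by positivity)
          _ = K * δ * (∑ k, |(Z₁ * T) k ℓ| + ∑ k, |(Z₂ * T) k ℓ|) := by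
              rw [← Finset.mul_sum, Finset.sum_add_distrib]
          _ ≤ _ := mul_le_mul_of_nonneg_left (by linarith) (by positivity)
      -- Cauchy–Schwarz costs a factor L here. It is affordable because the squares of all entries
      -- of Z₂T sum to at most 1, so that after summation over ℓ only one factor L remains.
      have a3 : (∑ k, |(Z₂ * T) k ℓ|) ^ 2 ≤ L * ∑ k, (Z₂ * T) k ℓ ^ 2 := by
        simpa using sq_sum_le_card_mul_sum_sq (s := (Finset.univ : Finset (Fin L)))
          (f := fun k => |(Z₂ * T) k ℓ|)
      rw [← sq_abs]
      refine (pow_le_pow_left₀ (abs_nonneg _) a1 2).trans ?_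
      rw [mul_pow]
      refine mul_le_mul_of_nonneg_left ?_ (sq_nonneg _)
      nlinarith [sq_nonneg (1 - 2 * ∑ k, |(Z₂ * T) k ℓ|)]
    have h2 : ∑ ℓ, ∑ k, (Z₂ * T) k ℓ ^ 2 ≤ 1 := by
      rw [Finset.sum_comm, ← frobNorm_sq]
      exact pow_le_one₀ (frobNorm_nonneg _) (h.frobNorm_fitPerturbation_mul_le hT')
    calc _ ≤ ∑ ℓ, (K * δ) ^ 2 * (2 + 8 * (L * ∑ k, (Z₂ * T) k ℓ ^ 2)) :=
          Finset.sum_le_sum fun ℓ _ => h1 ℓ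
      _ = (K * δ) ^ 2 * (2 * L + 8 * (L * ∑ ℓ, ∑ k, (Z₂ * T) k ℓ ^ 2)) := by
          rw [← Finset.mul_sum, Finset.sum_add_distrib, ← Finset.mul_sum, ← Finset.mul_sum]
          simp [mul_comm]
      _ ≤ (K * δ) ^ 2 * (2 * L + 8 * (L * 1)) := by gcongr
      _ = _ := by ring
  have hpt : ∀ a b : ℝ, (a - b) ^ 2 ≤ 2 * a ^ 2 + 2 * b ^ 2 := fun a b => by
    nlinarith [sq_nonneg (a + b)]
  calc _ ≤ ∑ ℓ, (2 * (∑ j, R j ℓ * (E * T) j ℓ) ^ 2 +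
          2 * (∑ k, (∑ j, β j k * R j ℓ) * ((Z₁ - Z₂) * T) k ℓ) ^ 2) :=
        Finset.sum_le_sum fun ℓ _ => by rw [hsplit]; exact hpt _ _
    _ ≤ _ := by
        rw [Finset.sum_add_distrib, ← Finset.mul_sum, ← Finset.mul_sum]
        linarith

end PerturbedRegression

end PluginError

/-! ### Exponential inequalities for i.i.d. sums -/

section Concentration

variable {𝓧 Ω : Type*} [MeasurableSpace 𝓧] [MeasurableSpace Ω]

/-- Chernoff's bound for a sum over an i.i.d. sample. -/
theorem measureReal_le_sum_le_exp {n : ℕ} {P : Measure 𝓧} [IsProbabilityMeasure P]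
    {μ : Measure Ω} {D : Fin n → Ω → 𝓧} (hD : ∀ i, HasLaw (D i) P μ) (hind : iIndepFun D μ)
    {f : 𝓧 → ℝ} (hf : Measurable f) (hint : Integrable (fun x => Real.exp (f x)) P) {a : ℝ}
    (ha : ∫ x, Real.exp (f x) ∂P ≤ Real.exp a) (s : ℝ) :
    μ.real {ω | s ≤ ∑ i, f (D i ω)} ≤ Real.exp (n * a - s) := by
  have hlaw := hind.hasLaw_pi hD
  have hset : MeasurableSet {x : Fin n → 𝓧 | s ≤ ∑ i, f (x i)} :=
    measurableSet_le measurable_const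
      (Finset.measurable_sum _ fun i _ => hf.comp (measurable_pi_apply i))
  rw [hlaw.measureReal_eq (p := fun x => s ≤ ∑ i, f (x i)) hset]
  have hexp : ∀ x : Fin n → 𝓧, Real.exp (∑ i, f (x i)) = ∏ i, Real.exp (f (x i)) := fun x =>
    Real.exp_sum _ _
  have hI : Integrable (fun x : Fin n → 𝓧 => Real.exp (∑ i, f (x i)))
      (Measure.pi fun _ => P) := by
    simp only [hexp]
    exact Integrable.fintype_prod fun _ => hint
  have hmarkov := mul_meas_ge_le_integral_of_nonneg
    (Filter.Eventually.of_forall fun x => (Real.exp_pos _).le) hI (Real.exp s)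
  simp only [hexp] at hmarkov
  rw [integral_fintype_prod_eq_pow (fun x => Real.exp (f x))] at hmarkov
  simp only [← hexp, Real.exp_le_exp, Fintype.card_fin] at hmarkov
  have h2 : (∫ x, Real.exp (f x) ∂P) ^ n ≤ Real.exp (n * a) := by
    rw [Real.exp_nat_mul]
    exact pow_le_pow_left₀ (integral_nonneg fun x => (Real.exp_pos _).le) ha n
  rw [Real.exp_sub, le_div_iff₀ (Real.exp_pos s), mul_comm]
  exact hmarkov.trans h2

/-- Bernstein's inequality for a sum over an i.i.d. sample. -/
theorem measureReal_lt_abs_sum_le {n : ℕ} (hn : 0 < n) {P : Measure 𝓧} [IsProbabilityMeasure P]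
    {μ : Measure Ω} [IsFiniteMeasure μ] {D : Fin n → Ω → 𝓧} (hD : ∀ i, HasLaw (D i) P μ)
    (hind : iIndepFun D μ) {f : 𝓧 → ℝ} (hf : Measurable f) {a t₀ : ℝ} (ha : 0 < a)
    (ht₀ : 0 ≤ t₀)
    (hmgf : ∀ t, |t| ≤ t₀ → Integrable (fun x => Real.exp (t * f x)) P ∧
      ∫ x, Real.exp (t * f x) ∂P ≤ Real.exp (a * t ^ 2))
    {s : ℝ} (hs : 0 ≤ s) (hst : s ≤ n * a * t₀ ^ 2) :
    μ.real {ω | 2 * Real.sqrt (s * (n * a)) < |∑ i, f (D i ω)|} ≤ 2 * Real.exp (-s) := by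
  have hn' : (0 : ℝ) < n := Nat.cast_pos.2 hn
  have hna : 0 < n * a := mul_pos hn' ha
  -- The minimiser of n a t² − t · 2√(s n a), with minimal value −s; the assumption s ≤ n a t₀² says
  -- exactly that it is admissible.
  set t := Real.sqrt (s / (n * a)) with ht
  have ht0 : 0 ≤ t := Real.sqrt_nonneg _
  have htt : t ^ 2 = s / (n * a) := Real.sq_sqrt (by positivity)
  have htle : t ≤ t₀ := by
    refine le_of_sq_le_sq ?_ ht₀
    rw [htt, div_le_iff₀ hna]
    linarith
  have hprod : t * (2 * Real.sqrt (s * (n * a))) = 2 * s := by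
    rw [ht, mul_left_comm, ← Real.sqrt_mul (by positivity)]
    have : s / (n * a) * (s * (n * a)) = s ^ 2 := by field_simp
    rw [this, Real.sqrt_sq hs]
  have hexp : n * (a * t ^ 2) - 2 * s = -s := by
    rw [htt]; field_simp; ring
  have key : ∀ r, |r| = t →
      μ.real {ω | 2 * s ≤ ∑ i, r * f (D i ω)} ≤ Real.exp (-s) := by
    intro r hr
    obtain ⟨h1, h2⟩ := hmgf r (hr.le.trans htle)
    rw [← sq_abs, hr] at h2
    have := measureReal_le_sum_le_exp hD hind (hf.const_mul r) h1 h2 (2 * s)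
    rwa [hexp] at this
  have hsub : {ω | 2 * Real.sqrt (s * (n * a)) < |∑ i, f (D i ω)|} ⊆
      {ω | 2 * s ≤ ∑ i, t * f (D i ω)} ∪ {ω | 2 * s ≤ ∑ i, -t * f (D i ω)} := by
    intro ω hω
    simp only [Set.mem_ofPred_eq, Set.mem_union, ← Finset.mul_sum] at hω ⊢
    rw [← hprod]
    rcases lt_abs.1 hω with h | h
    · exact Or.inl (mul_le_mul_of_nonneg_left h.le ht0)
    · right
      rw [neg_mul, ← mul_neg]
      exact mul_le_mul_of_nonneg_left h.le ht0
  calc _ ≤ μ.real ({ω | 2 * s ≤ ∑ i, t * f (D i ω)} ∪ {ω | 2 * s ≤ ∑ i, -t * f (D i ω)}) :=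
        measureReal_mono hsub
    _ ≤ _ := measureReal_union_le _ _
    _ ≤ Real.exp (-s) + Real.exp (-s) :=
        add_le_add (key t (abs_of_nonneg ht0)) (key (-t) (by rw [abs_neg, abs_of_nonneg ht0]))
    _ = _ := by ring

/-- Second-order Taylor remainder of the exponential series, valid without restriction on the size
of x. -/
theorem exp_le_one_add_add_sq_mul_exp_abs (x : ℝ) :
    Real.exp x ≤ 1 + x + x ^ 2 * Real.exp |x| := by
  have h := Complex.norm_exp_sub_sum_le_norm_mul_exp (x : ℂ) 2
  simp only [Finset.sum_range_succ, Finset.sum_range_zero, zero_add, pow_zero, pow_one,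
    Nat.factorial, Nat.cast_one, div_one, Complex.norm_real, Real.norm_eq_abs, sq_abs] at h
  norm_num at h
  have h2 : (Complex.exp x - (1 + x) : ℂ) = ((Real.exp x - (1 + x) : ℝ) : ℂ) := by push_cast; rfl
  rw [h2, Complex.norm_real, Real.norm_eq_abs] at h
  linarith [le_abs_self (Real.exp x - (1 + x))]

/-- A centred variable with a bounded exponential moment is sub-exponential. -/
theorem integral_exp_mul_sub_le {P : Measure 𝓧} [IsProbabilityMeasure P] {Z : 𝓧 → ℝ}
    (hZ : Measurable Z) {l C : ℝ} (hl : 0 < l)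
    (hint : Integrable (fun x => Real.exp (l * |Z x|)) P)
    (hC : ∫ x, Real.exp (l * |Z x|) ∂P ≤ C) {t : ℝ} (ht : |t| ≤ l / 2) :
    Integrable (fun x => Real.exp (t * (Z x - ∫ y, Z y ∂P))) P ∧
      ∫ x, Real.exp (t * (Z x - ∫ y, Z y ∂P)) ∂P ≤
        Real.exp (8 * (Real.exp C * C) / l ^ 2 * t ^ 2) := by
  set m := ∫ y, Z y ∂P with hm
  have hle : ∀ x, |Z x| ≤ l⁻¹ * Real.exp (l * |Z x|) := fun x => by
    rw [inv_mul_eq_div, le_div_iff₀ hl, mul_comm]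
    linarith [Real.add_one_le_exp (l * |Z x|)]
  have hZint : Integrable Z P := by
    refine (hint.const_mul l⁻¹).mono' hZ.aestronglyMeasurable (Filter.Eventually.of_forall ?_)
    intro x
    rw [Real.norm_eq_abs]
    exact hle x
  -- Averaging the pointwise inequality l|Z| ≤ exp(l|Z|).
  have hm_le : l * |m| ≤ C := by
    have h1 : |m| ≤ ∫ x, |Z x| ∂P := abs_integral_le_integral_abs
    have h2 : ∫ x, |Z x| ∂P ≤ ∫ x, l⁻¹ * Real.exp (l * |Z x|) ∂P :=
      integral_mono hZint.abs (hint.const_mul _) hle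
    rw [integral_const_mul] at h2
    calc l * |m| ≤ l * (l⁻¹ * C) := by
          refine mul_le_mul_of_nonneg_left ?_ hl.le
          exact (h1.trans h2).trans (mul_le_mul_of_nonneg_left hC (by positivity))
      _ = C := by field_simp
  -- One half of the exponential moment pays for the factor (Z − m)², the other half for exp|t(Z −
  -- m)|, as |t| ≤ l/2. Passing from Z − m to Z costs exp C. The linear term then integrates to
  -- zero.
  have hpt : ∀ x, Real.exp (t * (Z x - m)) ≤
      1 + t * (Z x - m) + t ^ 2 * (8 / l ^ 2 * Real.exp C) * Real.exp (l * |Z x|) := by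
    intro x
    set w := |Z x - m| with hw
    have hw0 : 0 ≤ w := abs_nonneg _
    have hwle : l * w ≤ C + l * |Z x| := by
      have : w ≤ |Z x| + |m| := abs_sub _ _
      nlinarith
    have h1 := exp_le_one_add_add_sq_mul_exp_abs (t * (Z x - m))
    have h2 : |t * (Z x - m)| ≤ l / 2 * w := by
      rw [abs_mul]; exact mul_le_mul_of_nonneg_right ht hw0
    have h3 : w ^ 2 ≤ 8 / l ^ 2 * Real.exp (l / 2 * w) := by
      rw [div_mul_eq_mul_div, le_div_iff₀ (by positivity)]
      have := Real.quadratic_le_exp_of_nonneg (x := l / 2 * w) (by positivity)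
      nlinarith [mul_nonneg hl.le hw0]
    have h4 : Real.exp (l / 2 * w) * Real.exp (l / 2 * w) ≤
        Real.exp C * Real.exp (l * |Z x|) := by
      rw [← Real.exp_add, ← Real.exp_add]
      exact Real.exp_le_exp.2 (by linarith)
    have h5 : (t * (Z x - m)) ^ 2 * Real.exp |t * (Z x - m)| ≤
        t ^ 2 * (8 / l ^ 2 * Real.exp C) * Real.exp (l * |Z x|) := by
      calc (t * (Z x - m)) ^ 2 * Real.exp |t * (Z x - m)|
          ≤ (t * (Z x - m)) ^ 2 * Real.exp (l / 2 * w) := by gcongr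
        _ = t ^ 2 * (w ^ 2 * Real.exp (l / 2 * w)) := by rw [mul_pow, hw, sq_abs]; ring
        _ ≤ t ^ 2 * (8 / l ^ 2 * Real.exp (l / 2 * w) * Real.exp (l / 2 * w)) := by gcongr
        _ = t ^ 2 * (8 / l ^ 2 * (Real.exp (l / 2 * w) * Real.exp (l / 2 * w))) := by ring
        _ ≤ t ^ 2 * (8 / l ^ 2 * (Real.exp C * Real.exp (l * |Z x|))) := by gcongr
        _ = _ := by ring
    linarith
  have hi0 : Integrable (fun x => t * (Z x - m)) P :=
    (hZint.sub (integrable_const m)).const_mul t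
  have hi1 : Integrable (fun x => 1 + t * (Z x - m)) P := (integrable_const 1).add hi0
  have hi2 : Integrable (fun x => t ^ 2 * (8 / l ^ 2 * Real.exp C) * Real.exp (l * |Z x|)) P :=
    hint.const_mul _
  have hI : Integrable (fun x => Real.exp (t * (Z x - m))) P := by
    refine (hi1.add hi2).mono' (by fun_prop) (Filter.Eventually.of_forall fun x => ?_)
    rw [Real.norm_eq_abs, Real.abs_exp]
    exact hpt x
  refine ⟨hI, (integral_mono hI (hi1.add hi2) hpt).trans ?_⟩
  have e1 : ∫ x, (1 + t * (Z x - m)) ∂P = 1 := by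
    rw [integral_add (integrable_const 1) hi0, integral_const_mul,
      integral_sub hZint (integrable_const m)]
    simp [hm]
  simp only [Pi.add_apply]
  rw [integral_add hi1 hi2, e1, integral_const_mul]
  calc _ ≤ 1 + t ^ 2 * (8 / l ^ 2 * Real.exp C) * C := by gcongr
    _ = 8 * (Real.exp C * C) / l ^ 2 * t ^ 2 + 1 := by ring
    _ ≤ _ := Real.add_one_le_exp _

/-- The exponential moment of the square of a Gaussian variable. -/
theorem integral_exp_mul_sq_gaussianReal_le {m l K : ℝ} {v : NNReal} (hm : |m| ≤ K)
    (hv : (v : ℝ) ≤ K) (hl : 0 < l) (hlK : 8 * l * K ≤ 1) :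
    Integrable (fun x => Real.exp (l * x ^ 2)) (gaussianReal m v) ∧
      ∫ x, Real.exp (l * x ^ 2) ∂(gaussianReal m v) ≤ 2 * Real.exp K := by
  have hK : 0 ≤ K := (abs_nonneg m).trans hm
  -- In the centred case the integrand is an unnormalised Gaussian density exp(−b x²) with b =
  -- 1/(2v) − 2l ≥ 1/(4v), because 8 l v ≤ 1. The variance may vanish, so the Dirac mass is treated
  -- separately.
  have hcenter : Integrable (fun x => Real.exp (2 * l * x ^ 2)) (gaussianReal 0 v) ∧
      ∫ x, Real.exp (2 * l * x ^ 2) ∂(gaussianReal 0 v) ≤ 2 := by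
    by_cases hv0 : v = 0
    · subst hv0
      rw [gaussianReal_zero_var]
      refine ⟨integrable_dirac (by simp), ?_⟩
      rw [integral_dirac]; simp
    have hvpos : (0 : ℝ) < v := by positivity
    set b : ℝ := 1 / (2 * v) - 2 * l with hb
    have hb0 : 1 / (4 * v) ≤ b := by
      have : 2 * l ≤ 1 / (4 * v) := by
        rw [le_div_iff₀ (by positivity)]; nlinarith
      have e : 1 / (2 * (v : ℝ)) = 1 / (4 * v) + 1 / (4 * v) := by field_simp; norm_num
      linarith
    have hbpos : 0 < b := lt_of_lt_of_le (by positivity) hb0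
    have hfun : (fun x => gaussianPDFReal 0 v x • Real.exp (2 * l * x ^ 2)) =
        fun x => (Real.sqrt (2 * Real.pi * v))⁻¹ * Real.exp (-b * x ^ 2) := by
      ext x
      rw [gaussianPDFReal, smul_eq_mul, mul_assoc, ← Real.exp_add]
      congr 2
      rw [hb]; field_simp; ring
    have hI : Integrable (fun x => gaussianPDFReal 0 v x • Real.exp (2 * l * x ^ 2)) := by
      rw [hfun]; exact (integrable_exp_neg_mul_sq hbpos).const_mul _
    constructor
    · rw [gaussianReal_of_var_ne_zero _ hv0, integrable_withDensity_iff_integrable_smul'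
        (measurable_gaussianPDF _ _) (Filter.Eventually.of_forall fun _ => gaussianPDF_lt_top)]
      simpa only [toReal_gaussianPDF] using hI
    · rw [integral_gaussianReal_eq_integral_smul hv0, hfun, integral_const_mul, integral_gaussian,
        ← Real.sqrt_inv, ← Real.sqrt_mul (by positivity)]
      refine Real.sqrt_le_iff.2 ⟨by norm_num, ?_⟩
      have hpi := Real.pi_pos
      have h1 : Real.pi / b ≤ Real.pi / (1 / (4 * v)) := by gcongr
      calc (2 * Real.pi * v)⁻¹ * (Real.pi / b) ≤
            (2 * Real.pi * v)⁻¹ * (Real.pi / (1 / (4 * v))) := by gcongr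
        _ = 2 := by field_simp; norm_num
        _ ≤ 2 ^ 2 := by norm_num
  have hmap : (gaussianReal 0 v).map (fun x => x + m) = gaussianReal m v := by
    rw [gaussianReal_map_add_const, zero_add]
  rw [← hmap]
  have hmeas : AEStronglyMeasurable (fun x : ℝ => Real.exp (l * x ^ 2))
      ((gaussianReal 0 v).map (fun x => x + m)) := by fun_prop
  rw [integrable_map_measure hmeas (by fun_prop), integral_map (by fun_prop) hmeas]
  -- The inequality (x + m)² ≤ 2x² + 2m² explains the doubled parameter 2l above; the mean
  -- contributes 2 l K² ≤ K.
  have hle : ∀ x : ℝ, Real.exp (l * (x + m) ^ 2) ≤ Real.exp K * Real.exp (2 * l * x ^ 2) := by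
    intro x
    rw [← Real.exp_add]
    refine Real.exp_le_exp.2 ?_
    have h1 : (x + m) ^ 2 ≤ 2 * x ^ 2 + 2 * m ^ 2 := by nlinarith [sq_nonneg (x - m)]
    have h2 : m ^ 2 ≤ K ^ 2 := sq_le_sq' (abs_le.1 hm).1 (abs_le.1 hm).2
    have h3 : l * (x + m) ^ 2 ≤ l * (2 * x ^ 2 + 2 * K ^ 2) := by gcongr; linarith
    nlinarith
  have hI : Integrable (fun x => Real.exp K * Real.exp (2 * l * x ^ 2)) (gaussianReal 0 v) :=
    hcenter.1.const_mul _
  have hI2 : Integrable (fun x => Real.exp (l * (x + m) ^ 2)) (gaussianReal 0 v) := by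
    refine hI.mono' (by fun_prop) (Filter.Eventually.of_forall fun x => ?_)
    rw [Real.norm_eq_abs, Real.abs_exp]
    exact hle x
  refine ⟨hI2, (integral_mono hI2 hI hle).trans ?_⟩
  rw [integral_const_mul, mul_comm]
  exact mul_le_mul_of_nonneg_right hcenter.2 (Real.exp_pos K).le

end Concentration

/-! ### One-dimensional projections of multivariate Gaussian laws -/

section GaussianProjection

variable {p : ℕ}

theorem measurable_sum_mul (v : Fin p → ℝ) :
    Measurable fun x : EuclideanSpace ℝ (Fin p) => ∑ j, v j * x j := by fun_prop

theorem map_sum_mul_multivariateGaussian (m : EuclideanSpace ℝ (Fin p))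
    {S : Matrix (Fin p) (Fin p) ℝ} (hS : S.PosSemidef) (v : Fin p → ℝ) :
    (multivariateGaussian m S).map (fun x => ∑ j, v j * x j) =
      gaussianReal (∑ j, v j * m j) (v ⬝ᵥ (S *ᵥ v)).toNNReal := by
  have hfun : (fun x : EuclideanSpace ℝ (Fin p) => ∑ j, v j * x j) =
      innerSL ℝ (WithLp.toLp 2 v) := by
    ext x
    simp [PiLp.inner_apply, mul_comm]
  have hvar : Var[innerSL ℝ (WithLp.toLp 2 v); multivariateGaussian m S] = v ⬝ᵥ (S *ᵥ v) := by
    have := covarianceBilin_multivariateGaussian (μ := m) hS (WithLp.toLp 2 v) (WithLp.toLp 2 v)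
    rw [covarianceBilin_self IsGaussian.memLp_two_id] at this
    exact this
  have hmean : ∫ x, innerSL ℝ (WithLp.toLp 2 v) x ∂(multivariateGaussian m S) =
      ∑ j, v j * m j := by
    rw [ContinuousLinearMap.integral_comp_id_comm IsGaussian.integrable_id,
      integral_id_multivariateGaussian, ← hfun]
  rw [hfun, IsGaussian.map_eq_gaussianReal, hvar, hmean]

theorem integral_sum_mul_mul_sum_mul_multivariateGaussian (m : EuclideanSpace ℝ (Fin p))
    {S : Matrix (Fin p) (Fin p) ℝ} (hS : S.PosSemidef) (u v : Fin p → ℝ) :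
    Integrable (fun x => (∑ j, u j * x j) * ∑ j, v j * x j) (multivariateGaussian m S) ∧
      ∫ x, (∑ j, u j * x j) * (∑ j, v j * x j) ∂(multivariateGaussian m S) =
        u ⬝ᵥ (S *ᵥ v) + (∑ j, u j * m j) * ∑ j, v j * m j := by
  have hfun : ∀ v : Fin p → ℝ, (fun x : EuclideanSpace ℝ (Fin p) => ∑ j, v j * x j) =
      innerSL ℝ (WithLp.toLp 2 v) := by
    intro v
    ext x
    simp [PiLp.inner_apply, mul_comm]
  have hmem : ∀ v : Fin p → ℝ, MemLp (fun x : EuclideanSpace ℝ (Fin p) => ∑ j, v j * x j) 2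
      (multivariateGaussian m S) := by
    intro v
    rw [hfun]
    exact (innerSL ℝ (WithLp.toLp 2 v)).comp_memLp' IsGaussian.memLp_two_id
  have hmean : ∀ v : Fin p → ℝ, ∫ x, ∑ j, v j * x j ∂(multivariateGaussian m S) =
      ∑ j, v j * m j := by
    intro v
    rw [hfun, ContinuousLinearMap.integral_comp_id_comm IsGaussian.integrable_id,
      integral_id_multivariateGaussian, ← hfun]
  refine ⟨(hmem u).integrable_mul (hmem v), ?_⟩
  have hcov := covariance_eq_sub (hmem u) (hmem v)
  have := covarianceBilin_multivariateGaussian (μ := m) hS (WithLp.toLp 2 u) (WithLp.toLp 2 v)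
  rw [covarianceBilin_apply_eq_cov IsGaussian.memLp_two_id] at this
  have h2 : cov[fun x => ∑ j, u j * x j, fun x => ∑ j, v j * x j; multivariateGaussian m S] =
      u ⬝ᵥ (S *ᵥ v) := by
    rw [hfun, hfun]; exact this
  rw [h2, hmean, hmean] at hcov
  simp only [Pi.mul_apply] at hcov
  linarith

theorem integral_exp_mul_sub_multivariateGaussian (m : EuclideanSpace ℝ (Fin p))
    {S : Matrix (Fin p) (Fin p) ℝ} (hS : S.PosSemidef) (v : Fin p → ℝ) (t : ℝ) :
    Integrable (fun x => Real.exp (t * (∑ j, v j * (x j - m j)))) (multivariateGaussian m S) ∧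
      ∫ x, Real.exp (t * (∑ j, v j * (x j - m j))) ∂(multivariateGaussian m S) =
        Real.exp ((v ⬝ᵥ (S *ᵥ v)) * t ^ 2 / 2) := by
  have hlaw := map_sum_mul_multivariateGaussian m hS v
  set a := ∑ j, v j * m j with ha
  have hfun : (fun x : EuclideanSpace ℝ (Fin p) => Real.exp (t * (∑ j, v j * (x j - m j)))) =
      fun x => (fun y => Real.exp (-(t * a)) * Real.exp (t * y)) (∑ j, v j * x j) := by
    ext x
    simp only [mul_sub, Finset.sum_sub_distrib]
    rw [← Real.exp_add, ← ha]
    congr 1; ring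
  have hq : 0 ≤ v ⬝ᵥ (S *ᵥ v) := by simpa using hS.dotProduct_mulVec_nonneg v
  have hmeas : AEStronglyMeasurable (fun y : ℝ => Real.exp (-(t * a)) * Real.exp (t * y))
      ((multivariateGaussian m S).map fun x => ∑ j, v j * x j) := by fun_prop
  rw [hfun]
  constructor
  · refine (integrable_map_measure hmeas (measurable_sum_mul v).aemeasurable).1 ?_
    rw [hlaw]
    exact (integrable_exp_mul_gaussianReal t).const_mul _
  · rw [← integral_map (measurable_sum_mul v).aemeasurable hmeas, hlaw, integral_const_mul]
    have := congrFun (mgf_fun_id_gaussianReal (μ := a) (v := (v ⬝ᵥ (S *ᵥ v)).toNNReal)) t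
    rw [mgf] at this
    rw [this, Real.coe_toNNReal _ hq, ← Real.exp_add]
    congr 1; ring

theorem integral_exp_mul_sq_multivariateGaussian_le (m : EuclideanSpace ℝ (Fin p))
    {S : Matrix (Fin p) (Fin p) ℝ} (hS : S.PosSemidef) (v : Fin p → ℝ) {K l : ℝ}
    (hm : |∑ j, v j * m j| ≤ K) (hv : v ⬝ᵥ (S *ᵥ v) ≤ K) (hl : 0 < l) (hlK : 8 * l * K ≤ 1) :
    Integrable (fun x => Real.exp (l * (∑ j, v j * x j) ^ 2)) (multivariateGaussian m S) ∧
      ∫ x, Real.exp (l * (∑ j, v j * x j) ^ 2) ∂(multivariateGaussian m S) ≤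
        2 * Real.exp K := by
  have hK : 0 ≤ K := (abs_nonneg _).trans hm
  obtain ⟨h1, h2⟩ := integral_exp_mul_sq_gaussianReal_le (v := (v ⬝ᵥ (S *ᵥ v)).toNNReal) hm
    (by rw [Real.coe_toNNReal']; exact max_le hv hK) hl hlK
  rw [← map_sum_mul_multivariateGaussian m hS v] at h1 h2
  have hmeas : AEStronglyMeasurable (fun y : ℝ => Real.exp (l * y ^ 2))
      ((multivariateGaussian m S).map fun x => ∑ j, v j * x j) := by fun_prop
  rw [integral_map (measurable_sum_mul v).aemeasurable hmeas] at h2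
  exact ⟨(integrable_map_measure hmeas (measurable_sum_mul v).aemeasurable).1 h1, h2⟩

end GaussianProjection

/-! ### Moments of the Gaussian mixture -/

section Model

variable {p L : ℕ} {P : Measure (Obs p L)} {M : Matrix (Fin p) (Fin L) ℝ}
  {SW : Matrix (Fin p) (Fin p) ℝ}

/-- The law of total expectation over the classes. -/
theorem IsLDAModel.integral_eq_sum (hP : IsLDAModel P M SW) {f : Obs p L → ℝ} (hf : Measurable f)
    (h : ∀ ℓ, Integrable (fun x => f (x, ℓ))
      (multivariateGaussian (WithLp.toLp 2 (fun j => M j ℓ)) SW)) :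
    Integrable f P ∧ ∫ z, f z ∂P = ∑ ℓ, classProb P ℓ *
      ∫ x, f (x, ℓ) ∂(multivariateGaussian (WithLp.toLp 2 (fun j => M j ℓ)) SW) := by
  have := hP.isProbabilityMeasure
  have hset : ∀ ℓ : Fin L, MeasurableSet {z : Obs p L | z.2 = ℓ} := fun ℓ =>
    measurable_snd (measurableSet_singleton ℓ)
  have hdec : ∑ ℓ, P {z | z.2 = ℓ} • P[|{z | z.2 = ℓ}] = P :=
    sum_meas_smul_cond_fiber measurable_snd P
  have hae : ∀ ℓ : Fin L, f =ᵐ[P[|{z | z.2 = ℓ}]] fun z => f (z.1, ℓ) := fun ℓ => by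
    filter_upwards [ae_cond_mem (hset ℓ)] with z hz
    have hz' : z.2 = ℓ := hz
    rw [← hz']
  have hfℓ : ∀ ℓ : Fin L, Measurable fun x : EuclideanSpace ℝ (Fin p) => f (x, ℓ) := fun ℓ =>
    hf.comp (by fun_prop)
  have hint : ∀ ℓ : Fin L, Integrable f P[|{z | z.2 = ℓ}] := fun ℓ => by
    have h1 := h ℓ
    rw [← (hP.gaussian ℓ).map_eq,
      integrable_map_measure (hfℓ ℓ).aestronglyMeasurable measurable_fst.aemeasurable] at h1
    exact h1.congr (hae ℓ).symm
  have hval : ∀ ℓ : Fin L, ∫ z, f z ∂P[|{z | z.2 = ℓ}] =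
      ∫ x, f (x, ℓ) ∂(multivariateGaussian (WithLp.toLp 2 (fun j => M j ℓ)) SW) := fun ℓ => by
    rw [integral_congr_ae (hae ℓ)]
    exact (hP.gaussian ℓ).integral_comp (hfℓ ℓ).aestronglyMeasurable
  have hsmul : ∀ ℓ ∈ Finset.univ, Integrable f (P {z | z.2 = ℓ} • P[|{z | z.2 = ℓ}]) :=
    fun ℓ _ => (hint ℓ).smul_measure (measure_ne_top _ _)
  constructor
  · rw [← hdec]
    exact integrable_finsetSum_measure.2 hsmul
  · conv_lhs => rw [← hdec]
    rw [integral_finsetSum_measure hsmul]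
    refine Finset.sum_congr rfl fun ℓ _ => ?_
    rw [integral_smul_measure, hval, smul_eq_mul]
    rfl

theorem IsLDAModel.sum_classProb (hP : IsLDAModel P M SW) : ∑ ℓ, classProb P ℓ = 1 := by
  have := hP.isProbabilityMeasure
  have h := (hP.integral_eq_sum (f := fun _ => 1) measurable_const fun ℓ => integrable_const _).2
  simpa using h.symm

theorem IsLDAModel.integral_mul_eq (hP : IsLDAModel P M SW) (u v : Fin p → ℝ) :
    ∫ z, (∑ j, u j * z.1 j) * (∑ j, v j * z.1 j) ∂P = u ⬝ᵥ (SW *ᵥ v) +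
      ∑ ℓ, classProb P ℓ * ((∑ j, u j * M j ℓ) * ∑ j, v j * M j ℓ) := by
  have h := fun ℓ => integral_sum_mul_mul_sum_mul_multivariateGaussian
    (WithLp.toLp 2 (fun j => M j ℓ)) hP.posDef.posSemidef u v
  rw [(hP.integral_eq_sum (f := fun z => (∑ j, u j * z.1 j) * (∑ j, v j * z.1 j)) (by fun_prop)
    fun ℓ => (h ℓ).1).2]
  simp only [(h _).2, mul_add, Finset.sum_add_distrib]
  rw [← Finset.sum_mul, hP.sum_classProb, one_mul]

theorem integrable_eval_multivariateGaussian (m : EuclideanSpace ℝ (Fin p))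
    (S : Matrix (Fin p) (Fin p) ℝ) (j : Fin p) :
    Integrable (fun x => x j) (multivariateGaussian m S) :=
  (EuclideanSpace.proj (𝕜 := ℝ) j).integrable_comp IsGaussian.integrable_id

theorem integral_eval_multivariateGaussian (m : EuclideanSpace ℝ (Fin p))
    (S : Matrix (Fin p) (Fin p) ℝ) (j : Fin p) :
    ∫ x, x j ∂(multivariateGaussian m S) = m j := by
  have := (EuclideanSpace.proj (𝕜 := ℝ) j).integral_comp_id_comm
    (μ := multivariateGaussian m S) IsGaussian.integrable_id
  simpa using this

theorem IsLDAModel.sum_classProb_mul_mean (hP : IsLDAModel P M SW) (j : Fin p) :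
    ∑ ℓ, classProb P ℓ * M j ℓ = 0 := by
  rw [← hP.mean_zero j, (hP.integral_eq_sum (f := fun z => z.1 j) (by fun_prop)
    fun ℓ => integrable_eval_multivariateGaussian _ _ j).2]
  simp only [integral_eval_multivariateGaussian]

theorem IsLDAModel.memLp_eval (hP : IsLDAModel P M SW) (j : Fin p) :
    MemLp (fun z : Obs p L => z.1 j) 2 P := by
  have hmeas : Measurable fun z : Obs p L => z.1 j := by fun_prop
  rw [memLp_two_iff_integrable_sq hmeas.aestronglyMeasurable]
  refine (hP.integral_eq_sum (f := fun z => z.1 j ^ 2) (by fun_prop) fun ℓ => ?_).1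
  have := (integral_sum_mul_mul_sum_mul_multivariateGaussian (WithLp.toLp 2 (fun j => M j ℓ))
    hP.posDef.posSemidef (Pi.single j 1) (Pi.single j 1)).1
  simpa [Pi.single_apply, sq] using this

theorem IsLDAModel.covX_eq (hP : IsLDAModel P M SW) :
    covX P = SW + M * diagonal (classProb P) * Mᵀ := by
  have := hP.isProbabilityMeasure
  ext i j
  rw [covX, of_apply, covariance_eq_sub (hP.memLp_eval i) (hP.memLp_eval j), hP.mean_zero,
    zero_mul, sub_zero]
  have h := hP.integral_mul_eq (Pi.single i 1) (Pi.single j 1)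
  simp only [Pi.single_apply, ite_mul, one_mul, zero_mul, Finset.sum_ite_eq', Finset.mem_univ,
    if_true] at h
  simp only [Pi.mul_apply, h, Matrix.add_apply]
  congr 1
  · simp
  · rw [Matrix.mul_apply]
    refine Finset.sum_congr rfl fun ℓ _ => ?_
    rw [mul_diagonal, transpose_apply]; ring

theorem IsLDAModel.covXY_eq (hP : IsLDAModel P M SW) :
    covXY P = M * diagonal (classProb P) := by
  have := hP.isProbabilityMeasure
  ext i ℓ
  have hmeas : Measurable fun z : Obs p L => oneHot z.2 ℓ :=
    (measurable_from_top (f := fun k : Fin L => oneHot k ℓ)).comp measurable_snd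
  have hmem : MemLp (fun z : Obs p L => oneHot z.2 ℓ) 2 P :=
    MemLp.of_bound hmeas.aestronglyMeasurable 1 (Filter.Eventually.of_forall fun z => by
      rw [oneHot]; split_ifs <;> simp)
  rw [covXY, of_apply, covariance_eq_sub (hP.memLp_eval i) hmem, hP.mean_zero, zero_mul, sub_zero,
    mul_diagonal]
  simp only [Pi.mul_apply]
  rw [(hP.integral_eq_sum (f := fun z => z.1 i * oneHot z.2 ℓ)
    (Measurable.mul (by fun_prop) hmeas)
    fun k => (integrable_eval_multivariateGaussian _ _ i).mul_const (oneHot k ℓ)).2]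
  have hterm : ∀ k : Fin L, ∫ x, x i * oneHot k ℓ
      ∂(multivariateGaussian (WithLp.toLp 2 (fun j => M j k)) SW) = M i k * oneHot k ℓ := fun k => by
    rw [integral_mul_const, integral_eval_multivariateGaussian]
  refine (Finset.sum_congr rfl fun k _ => congrArg (classProb P k * ·) (hterm k)).trans ?_
  simp [oneHot, mul_comm]

end Model

/-! ### The Gram matrix of the class means and the identity B = B* H -/

section Gram

variable {p L : ℕ} {P : Measure (Obs p L)} {M : Matrix (Fin p) (Fin L) ℝ}
  {SW : Matrix (Fin p) (Fin p) ℝ}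

/-- Testing the quadratic form on e_i ± e_j gives 2|G_ij| ≤ G_ii + G_jj. -/
theorem PosSemidef.abs_apply_le {ι : Type*} [Fintype ι] [DecidableEq ι] {G : Matrix ι ι ℝ}
    (hG : G.PosSemidef) {a : ℝ} (ha : ∀ i, G i i ≤ a) (i j : ι) : |G i j| ≤ a := by
  have hsymm : G j i = G i j := by
    have := congrFun (congrFun hG.isHermitian i) j
    simpa [conjTranspose_apply] using this
  have h1 := hG.dotProduct_mulVec_nonneg (Pi.single i 1 + Pi.single j 1)
  have h2 := hG.dotProduct_mulVec_nonneg (Pi.single i 1 - Pi.single j 1)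
  simp [mulVec_add, mulVec_sub, hsymm] at h1 h2
  rw [abs_le]
  constructor <;> linarith [ha i, ha j]

theorem discB_gram_posSemidef (hSW : SW.PosDef) : (Mᵀ * discB SW M).PosSemidef := by
  have := hSW.inv.posSemidef.conjTranspose_mul_mul_same M
  rwa [conjTranspose_eq_transpose_of_trivial, Matrix.mul_assoc] at this

theorem inv_transpose_eq (hSW : SW.PosDef) : (SW⁻¹)ᵀ = SW⁻¹ := by
  rw [← conjTranspose_eq_transpose_of_trivial]
  exact hSW.inv.isHermitian

theorem discB_transpose_mul (hSW : SW.PosDef) : (discB SW M)ᵀ * M = Mᵀ * discB SW M := by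
  rw [discB, transpose_mul, inv_transpose_eq hSW, Matrix.mul_assoc]

theorem mul_discB (hSW : SW.PosDef) : SW * discB SW M = M := by
  rw [discB, mul_nonsing_inv_cancel_left _ _ ((isUnit_iff_isUnit_det _).1 hSW.isUnit)]

theorem discB_quadratic (hSW : SW.PosDef) :
    (discB SW M)ᵀ * (SW * discB SW M) = Mᵀ * discB SW M := by
  rw [mul_discB hSW, discB_transpose_mul hSW]

theorem discB_dotProduct_mulVec (hSW : SW.PosDef) (k ℓ : Fin L) :
    (fun j => discB SW M j k) ⬝ᵥ (SW *ᵥ fun j => discB SW M j ℓ) = (Mᵀ * discB SW M) k ℓ := by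
  rw [← discB_quadratic hSW, Matrix.mul_apply]
  rfl

theorem sum_discB_mul (hSW : SW.PosDef) (k ℓ : Fin L) :
    ∑ j, discB SW M j k * M j ℓ = (Mᵀ * discB SW M) k ℓ := by
  rw [← discB_transpose_mul hSW, Matrix.mul_apply]
  rfl

theorem mahal_eq (hSW : SW.PosDef) (k ℓ : Fin L) :
    mahal SW M k ℓ = (Mᵀ * discB SW M) k k + (Mᵀ * discB SW M) ℓ ℓ -
      2 * (Mᵀ * discB SW M) k ℓ := by
  have hfun : ∀ k ℓ, (fun j => M j k) ⬝ᵥ (SW⁻¹ *ᵥ fun j => M j ℓ) = (Mᵀ * discB SW M) k ℓ := by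
    intro k ℓ
    rw [discB, Matrix.mul_apply]
    rfl
  have hsub : (fun j => M j k - M j ℓ) = (fun j => M j k) - fun j => M j ℓ := rfl
  have hsymm : (Mᵀ * discB SW M) ℓ k = (Mᵀ * discB SW M) k ℓ := by
    have := congrFun (congrFun (discB_gram_posSemidef (M := M) hSW).isHermitian k) ℓ
    simpa [conjTranspose_apply] using this
  rw [mahal, hsub, mulVec_sub, dotProduct_sub, sub_dotProduct, sub_dotProduct, hfun, hfun, hfun,
    hfun, hsymm]
  ring

theorem IsLDAModel.sum_classProb_mul_gram (hP : IsLDAModel P M SW) (ℓ : Fin L) :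
    ∑ k, classProb P k * (Mᵀ * discB SW M) k ℓ = 0 := by
  simp only [Matrix.mul_apply, transpose_apply, Finset.mul_sum]
  rw [Finset.sum_comm]
  refine Finset.sum_eq_zero fun j _ => ?_
  simp only [← mul_assoc, ← Finset.sum_mul]
  rw [hP.sum_classProb_mul_mean, zero_mul]

/-- Averaging the distances to class ℓ over k with weights π_k kills the cross term, since the class
means are centred. What remains is G_ℓℓ plus a nonnegative average, so every diagonal entry is at
most a; positive semidefiniteness handles the others. -/
theorem IsLDAModel.abs_gram_le (hP : IsLDAModel P M SW) {a : ℝ}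
    (ha : ∀ k ℓ, mahal SW M k ℓ ≤ a) (k ℓ : Fin L) : |(Mᵀ * discB SW M) k ℓ| ≤ a := by
  refine PosSemidef.abs_apply_le (discB_gram_posSemidef hP.posDef) (fun ℓ => ?_) k ℓ
  set G := Mᵀ * discB SW M with hG
  have h1 : ∑ k, classProb P k * mahal SW M k ℓ ≤ a := by
    calc _ ≤ ∑ k, classProb P k * a := Finset.sum_le_sum fun k _ =>
          mul_le_mul_of_nonneg_left (ha k ℓ) (hP.classProb_pos k).le
      _ = a := by rw [← Finset.sum_mul, hP.sum_classProb, one_mul]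
  have h2 : ∑ k, classProb P k * mahal SW M k ℓ = ∑ k, classProb P k * G k k + G ℓ ℓ := by
    have : ∀ k, classProb P k * mahal SW M k ℓ =
        classProb P k * G k k + classProb P k * G ℓ ℓ - 2 * (classProb P k * G k ℓ) := fun k => by
      rw [mahal_eq hP.posDef]; ring
    simp only [this]
    rw [Finset.sum_sub_distrib, Finset.sum_add_distrib, ← Finset.sum_mul, ← Finset.mul_sum,
      hP.sum_classProb, hP.sum_classProb_mul_gram]
    ring
  have h3 : 0 ≤ ∑ k, classProb P k * G k k := Finset.sum_nonneg fun k _ =>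
    mul_nonneg (hP.classProb_pos k).le (discB_gram_posSemidef hP.posDef).diag_nonneg
  linarith

theorem IsLDAModel.posDef_inv_add_gram (hP : IsLDAModel P M SW) :
    (diagonal (fun ℓ => (classProb P ℓ)⁻¹) + Mᵀ * discB SW M).PosDef :=
  (PosDef.diagonal fun ℓ => inv_pos.2 (hP.classProb_pos ℓ)).add_posSemidef
    (discB_gram_posSemidef hP.posDef)

theorem IsLDAModel.regB_eq (hP : IsLDAModel P M SW) :
    regB P = discB SW M * (diagonal (fun ℓ => (classProb P ℓ)⁻¹) + Mᵀ * discB SW M)⁻¹ := by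
  set J := diagonal (fun ℓ => (classProb P ℓ)⁻¹) + Mᵀ * discB SW M with hJ
  have hJu : IsUnit J.det := (isUnit_iff_isUnit_det _).1 hP.posDef_inv_add_gram.isUnit
  have hcov : (covX P).PosDef := by
    rw [hP.covX_eq]
    refine hP.posDef.add_posSemidef ?_
    have : (diagonal (classProb P)).PosSemidef :=
      PosSemidef.diagonal fun ℓ => (hP.classProb_pos ℓ).le
    have := this.mul_mul_conjTranspose_same M
    rwa [conjTranspose_eq_transpose_of_trivial] at this
  have hcu : IsUnit (covX P).det := (isUnit_iff_isUnit_det _).1 hcov.isUnit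
  have hd : diagonal (classProb P) * diagonal (fun ℓ => (classProb P ℓ)⁻¹) = 1 := by
    rw [diagonal_mul_diagonal, ← diagonal_one]
    exact congrArg _ (funext fun ℓ => mul_inv_cancel₀ (hP.classProb_pos ℓ).ne')
  -- Cov(X) B* = Σ_W B* + M D Mᵀ B* = M + M D G = M D (D⁻¹ + G).
  have key : covX P * discB SW M = M * diagonal (classProb P) * J := by
    rw [hP.covX_eq, Matrix.add_mul, mul_discB hP.posDef, hJ, Matrix.mul_add,
      Matrix.mul_assoc M (diagonal _) (diagonal _), hd, Matrix.mul_one]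
    simp only [Matrix.mul_assoc]
  rw [regB, hP.covXY_eq]
  calc _ = (covX P)⁻¹ * (M * diagonal (classProb P) * (J * J⁻¹)) := by
        rw [mul_nonsing_inv _ hJu, Matrix.mul_one]
    _ = (covX P)⁻¹ * (covX P * discB SW M * J⁻¹) := by
        rw [key]; simp only [Matrix.mul_assoc]
    _ = _ := by
        rw [Matrix.mul_assoc, nonsing_inv_mul_cancel_left _ _ hcu]

/-- The population second moments along the discriminant directions. -/
theorem IsLDAModel.integral_discB_mul (hP : IsLDAModel P M SW) (k ℓ : Fin L) :
    ∫ z, (∑ j, discB SW M j k * z.1 j) * (∑ j, discB SW M j ℓ * z.1 j) ∂P =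
      (Mᵀ * discB SW M * diagonal (classProb P) *
        (diagonal (fun ℓ => (classProb P ℓ)⁻¹) + Mᵀ * discB SW M)) k ℓ := by
  have hd : diagonal (classProb P) * diagonal (fun ℓ => (classProb P ℓ)⁻¹) = 1 := by
    rw [diagonal_mul_diagonal, ← diagonal_one]
    exact congrArg _ (funext fun ℓ => mul_inv_cancel₀ (hP.classProb_pos ℓ).ne')
  have hsymm : ∀ k ℓ, (Mᵀ * discB SW M) ℓ k = (Mᵀ * discB SW M) k ℓ := fun k ℓ => by
    have := congrFun (congrFun (discB_gram_posSemidef (M := M) hP.posDef).isHermitian k) ℓ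
    simpa [conjTranspose_apply] using this
  rw [hP.integral_mul_eq, discB_dotProduct_mulVec hP.posDef]
  simp only [sum_discB_mul hP.posDef]
  set G := Mᵀ * discB SW M
  rw [Matrix.mul_add, Matrix.mul_assoc G, hd, Matrix.mul_one, Matrix.add_apply]
  congr 1
  rw [Matrix.mul_apply]
  refine Finset.sum_congr rfl fun m _ => ?_
  rw [mul_diagonal, hsymm ℓ m]
  ring

end Gram

/-! ### Deviation bounds in the LDA model -/

section Deviations

variable {n p L : ℕ} {P : Measure (Obs p L)} {M : Matrix (Fin p) (Fin L) ℝ}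
  {SW : Matrix (Fin p) (Fin p) ℝ} {Ω : Type*} [MeasurableSpace Ω] {μ : Measure Ω}
  [IsProbabilityMeasure μ] {D : Fin n → Ω → Obs p L}

theorem measurable_oneHot (ℓ : Fin L) : Measurable fun z : Obs p L => oneHot z.2 ℓ :=
  (measurable_from_top (f := fun k : Fin L => oneHot k ℓ)).comp measurable_snd

/-- Deviation of the class frequencies. -/
theorem IsLDAModel.measureReal_frequency_deviation_le (hP : IsLDAModel P M SW) (hn : 0 < n)
    (hD : ∀ i, HasLaw (D i) P μ) (hind : iIndepFun D μ) (ℓ : Fin L) {s : ℝ} (hs : 0 ≤ s)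
    (hsn : s ≤ n * classProb P ℓ) :
    μ.real {ω | 2 * Real.sqrt (s * (n * classProb P ℓ)) <
      |∑ i, (oneHot (D i ω).2 ℓ - classProb P ℓ)|} ≤ 2 * Real.exp (-s) := by
  have := hP.isProbabilityMeasure
  set π := classProb P ℓ with hπ
  have hπ0 : 0 < π := hP.classProb_pos ℓ
  refine measureReal_lt_abs_sum_le hn hD hind (f := fun z => oneHot z.2 ℓ - π)
    ((measurable_oneHot ℓ).sub_const π) hπ0 zero_le_one (fun t ht => ?_) hs (by simpa using hsn)
  obtain ⟨h1, h2⟩ := hP.integral_eq_sum (f := fun z => Real.exp (t * (oneHot z.2 ℓ - π)))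
    (Real.measurable_exp.comp (((measurable_oneHot ℓ).sub_const π).const_mul t))
    fun k => integrable_const (Real.exp (t * (oneHot k ℓ - π)))
  refine ⟨h1, ?_⟩
  rw [h2]
  have hterm : ∀ k : Fin L, classProb P k *
      ∫ _x, Real.exp (t * (oneHot k ℓ - π))
        ∂(multivariateGaussian (WithLp.toLp 2 (fun j => M j k)) SW) =
      Real.exp (-(t * π)) *
        (classProb P k + if k = ℓ then classProb P k * (Real.exp t - 1) else 0) := by
    intro k
    rw [integral_const]
    by_cases hk : k = ℓ
    · simp only [oneHot, hk, if_true, probReal_univ, one_smul]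
      rw [mul_sub, mul_one, sub_eq_add_neg t, Real.exp_add]
      ring
    · simp only [oneHot, hk, if_false, probReal_univ, one_smul]
      rw [zero_sub, mul_neg]
      ring
  refine (Finset.sum_congr rfl fun k _ => hterm k).trans_le ?_
  rw [← Finset.mul_sum, Finset.sum_add_distrib, hP.sum_classProb]
  simp only [Finset.sum_ite_eq', Finset.mem_univ, if_true]
  rw [← hπ]
  -- This yields the exponent π t², with π in place of a constant: a class of probability of order
  -- 1/L needs fluctuations measured relative to its own size.
  have he : Real.exp t - 1 ≤ t + t ^ 2 := by
    linarith [le_abs_self (Real.exp t - 1 - t), Real.abs_exp_sub_one_sub_id_le ht]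
  calc Real.exp (-(t * π)) * (1 + π * (Real.exp t - 1))
      ≤ Real.exp (-(t * π)) * Real.exp (π * (Real.exp t - 1)) := by
        gcongr
        linarith [Real.add_one_le_exp (π * (Real.exp t - 1))]
    _ = Real.exp (π * (Real.exp t - 1) - t * π) := by rw [← Real.exp_add]; ring_nf
    _ ≤ Real.exp (π * t ^ 2) := by
        refine Real.exp_le_exp.2 ?_
        nlinarith

/-- The constant in the deviation bound for the second moments along directions with means and
variances bounded by `K`. -/
noncomputable def momentConst (K : ℝ) : ℝ :=
  8 * (Real.exp (2 * Real.exp K) * (2 * Real.exp K)) / (1 / (8 * K)) ^ 2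

/-- Deviation of the sample second moments. -/
theorem IsLDAModel.measureReal_moment_deviation_le (hP : IsLDAModel P M SW) (hn : 0 < n)
    (hD : ∀ i, HasLaw (D i) P μ) (hind : iIndepFun D μ) {K : ℝ} (hK : 0 < K) {u v : Fin p → ℝ}
    (hum : ∀ ℓ, |∑ j, u j * M j ℓ| ≤ K) (huv : u ⬝ᵥ (SW *ᵥ u) ≤ K)
    (hvm : ∀ ℓ, |∑ j, v j * M j ℓ| ≤ K) (hvv : v ⬝ᵥ (SW *ᵥ v) ≤ K)
    {s : ℝ} (hs : 0 ≤ s) (hsn : s ≤ n) :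
    μ.real {ω | 2 * Real.sqrt (s * (n * momentConst K)) <
      |∑ i, ((∑ j, u j * (D i ω).1 j) * (∑ j, v j * (D i ω).1 j) -
        ∫ z, (∑ j, u j * z.1 j) * (∑ j, v j * z.1 j) ∂P)|} ≤ 2 * Real.exp (-s) := by
  have := hP.isProbabilityMeasure
  -- The largest parameter allowed in the bound for exponential moments of squared Gaussians.
  set l : ℝ := 1 / (8 * K) with hl
  have hl0 : 0 < l := by positivity
  have hlK : 8 * l * K ≤ 1 := by rw [hl]; field_simp; exact le_rfl
  have hbound : ∀ ℓ, Integrable (fun x : EuclideanSpace ℝ (Fin p) =>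
        Real.exp (l * |(∑ j, u j * x j) * ∑ j, v j * x j|))
        (multivariateGaussian (WithLp.toLp 2 (fun j => M j ℓ)) SW) ∧
      ∫ x : EuclideanSpace ℝ (Fin p), Real.exp (l * |(∑ j, u j * x j) * ∑ j, v j * x j|)
        ∂(multivariateGaussian (WithLp.toLp 2 (fun j => M j ℓ)) SW) ≤ 2 * Real.exp K := by
    intro ℓ
    obtain ⟨a1, a2⟩ := integral_exp_mul_sq_multivariateGaussian_le
      (WithLp.toLp 2 (fun j => M j ℓ)) hP.posDef.posSemidef u (hum ℓ) huv hl0 hlK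
    obtain ⟨b1, b2⟩ := integral_exp_mul_sq_multivariateGaussian_le
      (WithLp.toLp 2 (fun j => M j ℓ)) hP.posDef.posSemidef v (hvm ℓ) hvv hl0 hlK
    -- Applying the arithmetic–geometric inequality twice, to the product and to the exponentials,
    -- reduces the product of two projections to their squares.
    have hle : ∀ x : EuclideanSpace ℝ (Fin p),
        Real.exp (l * |(∑ j, u j * x j) * ∑ j, v j * x j|) ≤
          (Real.exp (l * (∑ j, u j * x j) ^ 2) + Real.exp (l * (∑ j, v j * x j) ^ 2)) / 2 := by
      intro x
      set a := ∑ j, u j * x j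
      set b := ∑ j, v j * x j
      have h1 : |a * b| ≤ a ^ 2 / 2 + b ^ 2 / 2 := by
        rw [abs_mul]
        nlinarith [sq_nonneg (|a| - |b|), sq_abs a, sq_abs b]
      have h2 : Real.exp (l * |a * b|) ≤ Real.exp (l * a ^ 2 / 2) * Real.exp (l * b ^ 2 / 2) := by
        rw [← Real.exp_add]
        refine Real.exp_le_exp.2 ?_
        nlinarith
      have h3 : ∀ y : ℝ, Real.exp y = Real.exp (y / 2) ^ 2 := fun y => by
        rw [← Real.exp_nat_mul]; congr 1; push_cast; ring
      rw [h3 (l * a ^ 2), h3 (l * b ^ 2)]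
      nlinarith [sq_nonneg (Real.exp (l * a ^ 2 / 2) - Real.exp (l * b ^ 2 / 2))]
    have hI := (a1.add b1).div_const 2
    have hI2 : Integrable (fun x : EuclideanSpace ℝ (Fin p) =>
        Real.exp (l * |(∑ j, u j * x j) * ∑ j, v j * x j|))
        (multivariateGaussian (WithLp.toLp 2 (fun j => M j ℓ)) SW) := by
      refine hI.mono' ?_ (Filter.Eventually.of_forall fun x => ?_)
      · exact (Measurable.exp (((by fun_prop : Measurable
          fun x : EuclideanSpace ℝ (Fin p) => (∑ j, u j * x j) * ∑ j, v j * x j).abs).const_mul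
            l)).aestronglyMeasurable
      · rw [Real.norm_eq_abs, Real.abs_exp]; exact hle x
    refine ⟨hI2, (integral_mono hI2 hI hle).trans ?_⟩
    simp only [Pi.add_apply]
    rw [integral_div, integral_add a1 b1]
    linarith
  have hZ : Measurable fun z : Obs p L => (∑ j, u j * z.1 j) * ∑ j, v j * z.1 j := by fun_prop
  obtain ⟨h1, h2⟩ := hP.integral_eq_sum
    (f := fun z => Real.exp (l * |(∑ j, u j * z.1 j) * ∑ j, v j * z.1 j|))
    (Measurable.exp (hZ.abs.const_mul l)) fun ℓ => (hbound ℓ).1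
  have h3 : ∫ z, Real.exp (l * |(∑ j, u j * z.1 j) * ∑ j, v j * z.1 j|) ∂P ≤
      2 * Real.exp K := by
    rw [h2]
    calc _ ≤ ∑ ℓ, classProb P ℓ * (2 * Real.exp K) := Finset.sum_le_sum fun ℓ _ =>
          mul_le_mul_of_nonneg_left (hbound ℓ).2 (hP.classProb_pos ℓ).le
      _ = _ := by rw [← Finset.sum_mul, hP.sum_classProb, one_mul]
  have hconst : 0 < momentConst K := by rw [momentConst]; positivity
  refine measureReal_lt_abs_sum_le hn hD hind
    (f := fun z => (∑ j, u j * z.1 j) * (∑ j, v j * z.1 j) -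
        ∫ z, (∑ j, u j * z.1 j) * (∑ j, v j * z.1 j) ∂P)
    (hZ.sub_const _) hconst (t₀ := l / 2) (by positivity)
    (fun t ht => integral_exp_mul_sub_le hZ hl0 h1 h3 ht) hs ?_
  have e1 : 1 ≤ Real.exp (2 * Real.exp K) := Real.one_le_exp (by positivity)
  have e2 : 1 ≤ Real.exp K := Real.one_le_exp hK.le
  -- As this is at least 1, the condition s ≤ n suffices for Bernstein's inequality.
  have e3 : momentConst K * (l / 2) ^ 2 =
      4 * (Real.exp (2 * Real.exp K) * Real.exp K) := by
    rw [momentConst, ← hl]; field_simp; norm_num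
  rw [mul_assoc, e3]
  have e4 : 1 ≤ Real.exp (2 * Real.exp K) * Real.exp K := one_le_mul_of_one_le_of_one_le e1 e2
  have e5 : (0 : ℝ) ≤ n := Nat.cast_nonneg n
  nlinarith

/-- A self-normalised deviation bound for the within-class sums. -/
theorem IsLDAModel.measureReal_class_sum_deviation_le (hP : IsLDAModel P M SW)
    (hD : ∀ i, HasLaw (D i) P μ) (hind : iIndepFun D μ) (ℓ : Fin L) {v : Fin p → ℝ} {K : ℝ}
    (hv : v ⬝ᵥ (SW *ᵥ v) ≤ K) (t s : ℝ) :
    μ.real {ω | s + t ^ 2 * K / 2 * ∑ i, oneHot (D i ω).2 ℓ ≤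
      |t * ∑ i, oneHot (D i ω).2 ℓ * ∑ j, v j * ((D i ω).1 j - M j ℓ)|} ≤
        2 * Real.exp (-s) := by
  have := hP.isProbabilityMeasure
  have key : ∀ r : ℝ, r ^ 2 = t ^ 2 → μ.real {ω | s + t ^ 2 * K / 2 * ∑ i, oneHot (D i ω).2 ℓ ≤
      r * ∑ i, oneHot (D i ω).2 ℓ * ∑ j, v j * ((D i ω).1 j - M j ℓ)} ≤ Real.exp (-s) := by
    intro r hr
    -- The compensator t²K/2 is charged only to observations of class ℓ. Within that class it
    -- dominates the Gaussian log-moment; in other classes `f` vanishes. So the exponential moment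
    -- is at most 1, and the random class count stays in the bound without conditioning on the
    -- labels.
    set f : Obs p L → ℝ := fun z =>
      oneHot z.2 ℓ * (r * (∑ j, v j * (z.1 j - M j ℓ)) - t ^ 2 * K / 2) with hf
    have hfm : Measurable f := (measurable_oneHot ℓ).mul (by fun_prop)
    have hbound : ∀ k, Integrable (fun x => Real.exp (f (x, k)))
          (multivariateGaussian (WithLp.toLp 2 (fun j => M j k)) SW) ∧
        ∫ x, Real.exp (f (x, k))
          ∂(multivariateGaussian (WithLp.toLp 2 (fun j => M j k)) SW) ≤ 1 := by
      intro k
      by_cases hk : k = ℓ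
      · subst hk
        obtain ⟨h1, h2⟩ := integral_exp_mul_sub_multivariateGaussian
          (WithLp.toLp 2 (fun j => M j k)) hP.posDef.posSemidef v r
        have hfun : (fun x : EuclideanSpace ℝ (Fin p) => Real.exp (f (x, k))) = fun x =>
            Real.exp (r * ∑ j, v j * (x j - M j k)) * Real.exp (-(t ^ 2 * K / 2)) := by
          ext x
          rw [← Real.exp_add]
          simp [hf, oneHot, sub_eq_add_neg]
        rw [hfun]
        refine ⟨h1.mul_const _, ?_⟩
        rw [integral_mul_const]
        refine (congrArg (· * Real.exp (-(t ^ 2 * K / 2))) h2).trans_le ?_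
        simp only [← Real.exp_add]
        rw [Real.exp_le_one_iff, hr]
        nlinarith [sq_nonneg t]
      · have hfun : (fun x : EuclideanSpace ℝ (Fin p) => Real.exp (f (x, k))) = fun _ => 1 := by
          ext x
          simp [hf, oneHot, hk]
        rw [hfun]
        exact ⟨integrable_const _, by simp⟩
    obtain ⟨h1, h2⟩ := hP.integral_eq_sum (f := fun z => Real.exp (f z)) hfm.exp
      fun k => (hbound k).1
    have h3 : ∫ z, Real.exp (f z) ∂P ≤ Real.exp 0 := by
      rw [h2, Real.exp_zero, ← hP.sum_classProb]
      exact Finset.sum_le_sum fun k _ =>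
        mul_le_of_le_one_right (hP.classProb_pos k).le (hbound k).2
    have h4 := measureReal_le_sum_le_exp hD hind hfm h1 h3 s
    rw [mul_zero, zero_sub] at h4
    refine le_trans (measureReal_mono fun ω hω => ?_) h4
    simp only [Set.mem_ofPred_eq] at hω ⊢
    have hsum : ∑ i, f (D i ω) = r * ∑ i, oneHot (D i ω).2 ℓ * ∑ j, v j * ((D i ω).1 j - M j ℓ) -
        t ^ 2 * K / 2 * ∑ i, oneHot (D i ω).2 ℓ := by
      rw [Finset.mul_sum, Finset.mul_sum, ← Finset.sum_sub_distrib]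
      exact Finset.sum_congr rfl fun i _ => by rw [hf]; ring
    rw [hsum]
    linarith
  calc _ ≤ μ.real ({ω | s + t ^ 2 * K / 2 * ∑ i, oneHot (D i ω).2 ℓ ≤
          t * ∑ i, oneHot (D i ω).2 ℓ * ∑ j, v j * ((D i ω).1 j - M j ℓ)} ∪
        {ω | s + t ^ 2 * K / 2 * ∑ i, oneHot (D i ω).2 ℓ ≤
          -t * ∑ i, oneHot (D i ω).2 ℓ * ∑ j, v j * ((D i ω).1 j - M j ℓ)}) := by
        refine measureReal_mono fun ω hω => ?_
        simp only [Set.mem_ofPred_eq, Set.mem_union] at hω ⊢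
        rw [neg_mul]
        exact le_abs.1 hω
    _ ≤ _ := measureReal_union_le _ _
    _ ≤ Real.exp (-s) + Real.exp (-s) := add_le_add (key t rfl) (key (-t) (neg_sq t))
    _ = _ := by ring

end Deviations

/-! ### The sample matrices as class sums -/

section SampleAlgebra

variable {n p L : ℕ}

/-- The number of observations in class `ℓ`. -/
noncomputable def classCount (D : Fin n → Obs p L) (ℓ : Fin L) : ℝ := ∑ i, oneHot (D i).2 ℓ

theorem respMat_transpose_mul_self (D : Fin n → Obs p L) :
    (respMat D)ᵀ * respMat D = diagonal (classCount D) := by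
  ext k ℓ
  rw [Matrix.mul_apply, diagonal_apply]
  simp only [transpose_apply, respMat, of_apply, classCount]
  split_ifs with h
  · subst h
    exact Finset.sum_congr rfl fun i _ => by rw [oneHot]; split_ifs <;> simp
  · refine Finset.sum_eq_zero fun i _ => ?_
    simp only [oneHot]
    split_ifs with h1 h2 <;> simp
    exact h (h1.symm.trans h2)

theorem meanEst_sub_apply (D : Fin n → Obs p L) (M : Matrix (Fin p) (Fin L) ℝ)
    (hD : ∀ ℓ, classCount D ℓ ≠ 0) (j : Fin p) (ℓ : Fin L) :
    meanEst D j ℓ - M j ℓ =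
      (∑ i, oneHot (D i).2 ℓ * ((D i).1 j - M j ℓ)) / classCount D ℓ := by
  have hinv : (diagonal (classCount D))⁻¹ = diagonal (fun ℓ => (classCount D ℓ)⁻¹) := by
    refine inv_eq_right_inv ?_
    rw [diagonal_mul_diagonal, ← diagonal_one]
    exact congrArg _ (funext fun ℓ => mul_inv_cancel₀ (hD ℓ))
  have h1 : meanEst D j ℓ = (∑ i, oneHot (D i).2 ℓ * (D i).1 j) / classCount D ℓ := by
    rw [meanEst, respMat_transpose_mul_self, hinv, mul_diagonal, Matrix.mul_apply, div_eq_mul_inv]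
    congr 1
    exact Finset.sum_congr rfl fun i _ => by simp [featMat, respMat, mul_comm]
  rw [h1, eq_div_iff (hD ℓ), sub_mul, div_mul_cancel₀ _ (hD ℓ)]
  simp only [mul_sub, Finset.sum_sub_distrib]
  rw [← Finset.sum_mul, ← classCount, mul_comm (M j ℓ)]

theorem sum_mul_meanEst_sub (D : Fin n → Obs p L) (M : Matrix (Fin p) (Fin L) ℝ)
    (hD : ∀ ℓ, classCount D ℓ ≠ 0) (v : Fin p → ℝ) (ℓ : Fin L) :
    ∑ j, v j * (meanEst D j ℓ - M j ℓ) =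
      (∑ i, oneHot (D i).2 ℓ * ∑ j, v j * ((D i).1 j - M j ℓ)) / classCount D ℓ := by
  simp only [meanEst_sub_apply D M hD, Finset.mul_sum, Finset.sum_div]
  rw [Finset.sum_comm]
  exact Finset.sum_congr rfl fun i _ => Finset.sum_congr rfl fun j _ => by ring

/-- The feature matrix scaled by `n^{-1/2}`. -/
noncomputable def scaledFeat (D : Fin n → Obs p L) : Matrix (Fin n) (Fin p) ℝ :=
  (1 / Real.sqrt n) • featMat D

theorem plugH_eq (D : Fin n → Obs p L) (A : Matrix (Fin p) (Fin L) ℝ) :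
    plugH D A = diagonal (fun ℓ => classCount D ℓ / n) -
      (scaledFeat D * A)ᵀ * (scaledFeat D * A) := by
  have h1 : (1 / Real.sqrt n) * (1 / Real.sqrt n) = 1 / (n : ℝ) := by
    rw [div_mul_div_comm, Real.mul_self_sqrt (Nat.cast_nonneg n), one_mul]
  have h2 : (diagonal (fun ℓ => classCount D ℓ / n) : Matrix (Fin L) (Fin L) ℝ) =
      (1 / (n : ℝ)) • diagonal (classCount D) := by
    rw [← diagonal_smul]
    exact congrArg _ (funext fun ℓ => by simp [div_eq_inv_mul])
  rw [plugH, respMat_transpose_mul_self, smul_sub, h2, scaledFeat, Matrix.smul_mul, transpose_smul,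
    Matrix.smul_mul, Matrix.mul_smul, smul_smul, h1, transpose_mul]
  simp only [Matrix.mul_assoc]

theorem scaledFeat_gram_apply (D : Fin n → Obs p L) (A : Matrix (Fin p) (Fin L) ℝ) (k ℓ : Fin L) :
    ((scaledFeat D * A)ᵀ * (scaledFeat D * A)) k ℓ =
      (∑ i, (∑ j, A j k * (D i).1 j) * ∑ j, A j ℓ * (D i).1 j) / n := by
  have h1 : (1 / Real.sqrt n) * (1 / Real.sqrt n) = 1 / (n : ℝ) := by
    rw [div_mul_div_comm, Real.mul_self_sqrt (Nat.cast_nonneg n), one_mul]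
  rw [scaledFeat, Matrix.smul_mul, transpose_smul, Matrix.smul_mul, Matrix.mul_smul, smul_smul, h1,
    Matrix.smul_apply, smul_eq_mul, one_div_mul_eq_div]
  congr 1
  rw [Matrix.mul_apply]
  refine Finset.sum_congr rfl fun i _ => ?_
  simp only [transpose_apply, Matrix.mul_apply, featMat, of_apply]
  simp only [mul_comm]

end SampleAlgebra

/-! ### Good samples and their probability -/

section GoodSample

variable {n p L : ℕ} {P : Measure (Obs p L)} {M : Matrix (Fin p) (Fin L) ℝ}
  {SW : Matrix (Fin p) (Fin p) ℝ}

/-- The sample `D` has class frequencies, second moments along the discriminant directions, and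
class means close to their population values, at the scales given by `δ` and `ρ`. -/
structure GoodSample (P : Measure (Obs p L)) (M : Matrix (Fin p) (Fin L) ℝ)
    (SW : Matrix (Fin p) (Fin p) ℝ) (K δ ρ : ℝ) (D : Fin n → Obs p L) : Prop where
  frequency : ∀ ℓ, |classCount D ℓ / n - classProb P ℓ| ≤ K * δ / L
  moment : ∀ k ℓ, |((scaledFeat D * discB SW M)ᵀ * (scaledFeat D * discB SW M) -
    Mᵀ * discB SW M * diagonal (classProb P) *
      (diagonal (fun ℓ => (classProb P ℓ)⁻¹) + Mᵀ * discB SW M)) k ℓ| ≤ K * δ / Real.sqrt L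
  projected_mean : ∀ k ℓ, |∑ j, discB SW M j k * (meanEst D j ℓ - M j ℓ)| ≤ K * δ
  mean : ∀ j ℓ, |meanEst D j ℓ - M j ℓ| ≤ K * ρ

/-- The chosen multiplier makes the compensator at most s when N ≤ 2nπ, so |W| is at most 2s divided
by the multiplier; the lower bound on `N` then controls the quotient. -/
theorem abs_div_le_of_self_normalized {W N nπ K s : ℝ} (hnπ : 0 < nπ) (hK : 0 < K) (hs : 0 < s)
    (hN1 : nπ / 2 ≤ N) (hN2 : N ≤ 2 * nπ)
    (h : |Real.sqrt (s / (nπ * K)) * W| < s + Real.sqrt (s / (nπ * K)) ^ 2 * K / 2 * N) :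
    |W / N| ≤ 4 * Real.sqrt (s * K / nπ) := by
  have hN : 0 < N := lt_of_lt_of_le (by positivity) hN1
  set t := Real.sqrt (s / (nπ * K)) with ht
  have ht0 : 0 < t := Real.sqrt_pos.2 (by positivity)
  have htt : t ^ 2 = s / (nπ * K) := Real.sq_sqrt (by positivity)
  have h1 : t * |W| ≤ 2 * s := by
    rw [abs_mul, abs_of_pos ht0] at h
    have : t ^ 2 * K / 2 * N ≤ s := by
      calc t ^ 2 * K / 2 * N ≤ t ^ 2 * K / 2 * (2 * nπ) := by gcongr
        _ = s := by rw [htt]; field_simp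
    linarith
  have h2 : t * Real.sqrt (s * K / nπ) = s / nπ := by
    rw [ht, ← Real.sqrt_mul (by positivity)]
    have : s / (nπ * K) * (s * K / nπ) = (s / nπ) ^ 2 := by field_simp
    rw [this, Real.sqrt_sq (by positivity)]
  rw [abs_div, abs_of_pos hN, div_le_iff₀ hN]
  refine le_of_mul_le_mul_left ?_ ht0
  calc t * |W| ≤ 2 * s := h1
    _ = 4 * (s / nπ) * (nπ / 2) := by field_simp; norm_num
    _ ≤ 4 * (s / nπ) * N := by gcongr
    _ = t * (4 * Real.sqrt (s * K / nπ) * N) := by rw [← h2]; ring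

theorem measureReal_setOf_exists_le {Ω ι : Type*} [MeasurableSpace Ω] {μ : Measure Ω} [Fintype ι] {A : ι → Set Ω} {b : ℝ}
    (h : ∀ i, μ.real (A i) ≤ b) : μ.real {ω | ∃ i, ω ∈ A i} ≤ Fintype.card ι * b := by
  have : {ω | ∃ i, ω ∈ A i} = ⋃ i, A i := by ext; simp
  rw [this]
  refine (measureReal_iUnion_fintype_le A).trans ?_
  refine (Finset.sum_le_sum fun i _ => h i).trans (le_of_eq ?_)
  simp

variable {Ω : Type*} [MeasurableSpace Ω] {μ : Measure Ω} [IsProbabilityMeasure μ]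
  {D : Fin n → Ω → Obs p L}

theorem measureReal_le_add_of_forall_notMem {S A B C E : Set Ω}
    (h : ∀ ω, ω ∉ A → ω ∉ B → ω ∉ C → ω ∉ E → ω ∉ S) :
    μ.real S ≤ μ.real A + (μ.real B + (μ.real C + μ.real E)) := by
  have hsub : S ⊆ A ∪ (B ∪ (C ∪ E)) := by
    intro ω hω
    by_contra hcon
    simp only [Set.mem_union, not_or] at hcon
    exact h ω hcon.1 hcon.2.1 hcon.2.2.1 hcon.2.2.2 hω
  have h1 := measureReal_union_le (μ := μ) A (B ∪ (C ∪ E))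
  have h2 := measureReal_union_le (μ := μ) B (C ∪ E)
  have h3 := measureReal_union_le (μ := μ) C E
  linarith [measureReal_mono hsub (μ := μ)]

/-- The constant in the deviation bounds of a good sample. -/
noncomputable def sampleConst (K : ℝ) : ℝ := 10 * K + 2 * Real.sqrt (6 * momentConst K)

theorem momentConst_pos {K : ℝ} (hK : 0 < K) : 0 < momentConst K := by
  rw [momentConst]; positivity

theorem le_sampleConst {K : ℝ} : 10 * K ≤ sampleConst K := by
  rw [sampleConst]; linarith [Real.sqrt_nonneg (6 * momentConst K)]

/-- The deterministic half: the frequency bound first pins every class count within a factor two of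
its expectation. Only then are the class means genuine averages and the self-normalised bounds
usable. -/
theorem goodSample_of_deviations {D : Fin n → Obs p L} (hn : 3 ≤ n) {K : ℝ} (hK : 1 ≤ K)
    (hP : IsLDAModel P M SW) (hL : 1 ≤ L)
    (hπ1 : ∀ ℓ, (classProb P ℓ)⁻¹ ≤ K * L) (hπ2 : ∀ ℓ, classProb P ℓ ≤ K / L)
    (hlog : 96 * K * (L * Real.log n) ≤ n)
    (hA : ∀ ℓ, |∑ i, (oneHot (D i).2 ℓ - classProb P ℓ)| ≤
      2 * Real.sqrt (6 * Real.log n * (n * classProb P ℓ)))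
    (hB : ∀ k ℓ, |∑ i, ((∑ j, discB SW M j k * (D i).1 j) * (∑ j, discB SW M j ℓ * (D i).1 j) -
        ∫ z, (∑ j, discB SW M j k * z.1 j) * (∑ j, discB SW M j ℓ * z.1 j) ∂P)| ≤
      2 * Real.sqrt (6 * Real.log n * (n * momentConst K)))
    (hC : ∀ k ℓ, |Real.sqrt (6 * Real.log n / (n * classProb P ℓ * K)) *
        ∑ i, oneHot (D i).2 ℓ * ∑ j, discB SW M j k * ((D i).1 j - M j ℓ)| <
      6 * Real.log n + Real.sqrt (6 * Real.log n / (n * classProb P ℓ * K)) ^ 2 * K / 2 *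
        ∑ i, oneHot (D i).2 ℓ)
    (hE : ∀ j ℓ, |Real.sqrt (6 * Real.log (max (n : ℝ) p) / (n * classProb P ℓ * K)) *
        ∑ i, oneHot (D i).2 ℓ * ∑ j', (Pi.single j 1 : Fin p → ℝ) j' * ((D i).1 j' - M j' ℓ)| <
      6 * Real.log (max (n : ℝ) p) +
        Real.sqrt (6 * Real.log (max (n : ℝ) p) / (n * classProb P ℓ * K)) ^ 2 * K / 2 *
        ∑ i, oneHot (D i).2 ℓ) :
    GoodSample P M SW (sampleConst K) (Real.sqrt (L * Real.log n / n))
      (Real.sqrt (L * Real.log (max (n : ℝ) p) / n)) D := by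
  have hn3 : (3 : ℝ) ≤ n := by exact_mod_cast hn
  have hn0 : (0 : ℝ) < n := by linarith
  have hL1 : (1 : ℝ) ≤ L := by exact_mod_cast hL
  have hL0 : (0 : ℝ) < L := by linarith
  have hK0 : 0 < K := by linarith
  have hlog0 : 0 < Real.log n := Real.log_pos (by linarith)
  have hlogm : 0 < Real.log (max (n : ℝ) p) :=
    Real.log_pos (lt_of_lt_of_le (by linarith) (le_max_left _ _))
  set δ := Real.sqrt (L * Real.log n / n) with hδ
  have hδ0 : 0 ≤ δ := Real.sqrt_nonneg _
  have hδδ : δ ^ 2 = L * Real.log n / n := Real.sq_sqrt (by positivity)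
  have hπ0 := hP.classProb_pos
  have hKs := le_sampleConst (K := K)
  have hsum : ∀ ℓ, ∑ i, (oneHot (D i).2 ℓ - classProb P ℓ) =
      classCount D ℓ - n * classProb P ℓ := fun ℓ => by
    rw [Finset.sum_sub_distrib, classCount]; simp
  -- The constant 96 = 6 · 4²: 6 log n · nπ ≤ (nπ/4)² is the same as 96 log n ≤ nπ.
  have hdev : ∀ ℓ, |classCount D ℓ - n * classProb P ℓ| ≤ n * classProb P ℓ / 2 := by
    intro ℓ
    rw [← hsum]
    refine (hA ℓ).trans ?_
    have hπL : 1 ≤ classProb P ℓ * (K * L) := by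
      have := hπ1 ℓ
      rwa [inv_le_iff_one_le_mul₀' (hπ0 ℓ)] at this
    have h1 : 96 * Real.log n ≤ n * classProb P ℓ := by
      calc 96 * Real.log n = 96 * Real.log n * 1 := by ring
        _ ≤ 96 * Real.log n * (classProb P ℓ * (K * L)) := by gcongr
        _ = 96 * K * (L * Real.log n) * classProb P ℓ := by ring
        _ ≤ n * classProb P ℓ := mul_le_mul_of_nonneg_right hlog (hπ0 ℓ).le
    have hnπ : 0 < n * classProb P ℓ := mul_pos hn0 (hπ0 ℓ)
    have h2 : Real.sqrt (6 * Real.log n * (n * classProb P ℓ)) ≤ n * classProb P ℓ / 4 := by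
      refine Real.sqrt_le_iff.2 ⟨by positivity, ?_⟩
      nlinarith
    linarith
  have hN1 : ∀ ℓ, n * classProb P ℓ / 2 ≤ classCount D ℓ := fun ℓ => by
    linarith [(abs_le.1 (hdev ℓ)).1]
  have hN2 : ∀ ℓ, classCount D ℓ ≤ 2 * (n * classProb P ℓ) := fun ℓ => by
    linarith [(abs_le.1 (hdev ℓ)).2, mul_pos hn0 (hπ0 ℓ)]
  have hN0 : ∀ ℓ, classCount D ℓ ≠ 0 := fun ℓ =>
    (lt_of_lt_of_le (by have := hπ0 ℓ; positivity) (hN1 ℓ)).ne'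
  -- Since √6 ≤ 5/2, the factor 4√6 K is at most 10 K, the first summand of `sampleConst`.
  have hscale : ∀ (ℓ : Fin L) (l : ℝ), 0 ≤ l →
      4 * Real.sqrt (6 * l * K / (n * classProb P ℓ)) ≤
        10 * K * Real.sqrt (L * l / n) := by
    intro ℓ l hl
    have hπ := hπ0 ℓ
    have h1 : 6 * l * K / (n * classProb P ℓ) ≤ 6 * K ^ 2 * (L * l / n) := by
      calc 6 * l * K / (n * classProb P ℓ) = 6 * l * K / n * (classProb P ℓ)⁻¹ := by
            rw [← div_div]; rfl
        _ ≤ 6 * l * K / n * (K * L) := by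
            refine mul_le_mul_of_nonneg_left (hπ1 ℓ) (by positivity)
        _ = _ := by ring
    have h2 : Real.sqrt (6 * l * K / (n * classProb P ℓ)) ≤
        5 / 2 * K * Real.sqrt (L * l / n) := by
      refine Real.sqrt_le_iff.2 ⟨by positivity, h1.trans ?_⟩
      rw [mul_pow, Real.sq_sqrt (by positivity)]
      have : 0 ≤ K ^ 2 * (L * l / n) := by positivity
      nlinarith
    linarith
  refine ⟨fun ℓ => ?_, fun k ℓ => ?_, fun k ℓ => ?_, fun j ℓ => ?_⟩
  · have h1 : classCount D ℓ / n - classProb P ℓ = (classCount D ℓ - n * classProb P ℓ) / n := by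
      field_simp
    have h2 : Real.sqrt (6 * Real.log n * (n * classProb P ℓ)) ≤ 5 * K * δ / L * n := by
      refine Real.sqrt_le_iff.2 ⟨by positivity, ?_⟩
      calc 6 * Real.log n * (n * classProb P ℓ) ≤ 6 * Real.log n * (n * (K / L)) := by
            gcongr; exact hπ2 ℓ
        _ ≤ 25 * Real.log n * (n * (K ^ 2 / L)) := by
            gcongr
            · norm_num
            · nlinarith
        _ = (5 * K / L * n) ^ 2 * δ ^ 2 := by rw [hδδ]; field_simp; norm_num
        _ = _ := by ring
    rw [h1, abs_div, abs_of_pos hn0, div_le_iff₀ hn0, ← hsum]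
    calc _ ≤ 2 * Real.sqrt (6 * Real.log n * (n * classProb P ℓ)) := hA ℓ
      _ ≤ 2 * (5 * K * δ / L * n) := by gcongr
      _ = 10 * K * δ / L * n := by ring
      _ ≤ _ := by gcongr
  · have hn1 : (n : ℝ) ≠ 0 := hn0.ne'
    have hm := momentConst_pos hK0
    rw [Matrix.sub_apply, scaledFeat_gram_apply, ← hP.integral_discB_mul]
    have h1 := hB k ℓ
    rw [Finset.sum_sub_distrib, Finset.sum_const, Finset.card_univ, Fintype.card_fin,
      nsmul_eq_mul] at h1
    set I := ∫ z, (∑ j, discB SW M j k * z.1 j) * (∑ j, discB SW M j ℓ * z.1 j) ∂P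
    set Y := ∑ i, (∑ j, discB SW M j k * (D i).1 j) * (∑ j, discB SW M j ℓ * (D i).1 j)
    have h2 : Y / n - I = (Y - n * I) / n := by field_simp
    -- The natural scale √(log n / n) of these moments is δ/√L.
    have h3 : Real.sqrt (6 * Real.log n * (n * momentConst K)) =
        Real.sqrt (6 * momentConst K) * (δ / Real.sqrt L) * n := by
      have : 6 * Real.log n * (n * momentConst K) =
          6 * momentConst K * (L * Real.log n / n / L) * n ^ 2 := by field_simp
      rw [this, Real.sqrt_mul (by positivity), Real.sqrt_sq hn0.le, Real.sqrt_mul (by positivity),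
        Real.sqrt_div (by positivity)]
    rw [h2, abs_div, abs_of_pos hn0, div_le_iff₀ hn0]
    refine h1.trans ?_
    rw [h3]
    calc _ = 2 * Real.sqrt (6 * momentConst K) * δ / Real.sqrt L * n := by ring
      _ ≤ _ := by
        gcongr
        rw [sampleConst]; linarith
  · rw [sum_mul_meanEst_sub D M hN0]
    have := abs_div_le_of_self_normalized (mul_pos hn0 (hπ0 ℓ)) hK0 (by positivity)
      (hN1 ℓ) (hN2 ℓ) (hC k ℓ)
    exact this.trans ((hscale ℓ _ hlog0.le).trans (mul_le_mul_of_nonneg_right hKs hδ0))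
  · have h0 := sum_mul_meanEst_sub D M hN0 (Pi.single j 1) ℓ
    have h1 : ∑ j', (Pi.single j 1 : Fin p → ℝ) j' * (meanEst D j' ℓ - M j' ℓ) =
        meanEst D j ℓ - M j ℓ := by simp [Pi.single_apply]
    rw [← h1, h0]
    have := abs_div_le_of_self_normalized (mul_pos hn0 (hπ0 ℓ)) hK0 (by positivity)
      (hN1 ℓ) (hN2 ℓ) (hE j ℓ)
    exact this.trans ((hscale ℓ _ hlogm.le).trans
      (mul_le_mul_of_nonneg_right hKs (Real.sqrt_nonneg _)))

/-- A sample is good with probability at least `1 - 1 / n`. -/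
theorem IsLDAModel.measureReal_not_goodSample_le (hP : IsLDAModel P M SW) (hn : 3 ≤ n)
    (hD : ∀ i, HasLaw (D i) P μ) (hind : iIndepFun D μ) {K : ℝ} (hK : 1 ≤ K) (hL : 1 ≤ L)
    (hπ1 : ∀ ℓ, (classProb P ℓ)⁻¹ ≤ K * L) (hπ2 : ∀ ℓ, classProb P ℓ ≤ K / L)
    (hG : ∀ k ℓ, |(Mᵀ * discB SW M) k ℓ| ≤ K) (hSW : ∀ j, SW j j ≤ K)
    (hlog : 96 * K * (L * Real.log n) ≤ n) :
    μ.real {ω | ¬ GoodSample P M SW (sampleConst K) (Real.sqrt (L * Real.log n / n))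
      (Real.sqrt (L * Real.log (max (n : ℝ) p) / n)) fun i => D i ω} ≤ 1 / n := by
  have hn3 : (3 : ℝ) ≤ n := by exact_mod_cast hn
  have hn0 : (0 : ℝ) < n := by linarith
  have hL1 : (1 : ℝ) ≤ L := by exact_mod_cast hL
  have hL0 : (0 : ℝ) < L := by linarith
  have hK0 : 0 < K := by linarith
  have hlog1 : 1 ≤ Real.log n := by
    rw [Real.le_log_iff_exp_le hn0]
    linarith [Real.exp_one_lt_d9]
  set m : ℝ := max (n : ℝ) p with hm
  have hnm : (n : ℝ) ≤ m := le_max_left _ _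
  have hpm : (p : ℝ) ≤ m := le_max_right _ _
  have hm0 : 0 < m := by linarith
  have hLn : (L : ℝ) ≤ n := by nlinarith [mul_le_mul hK hlog1 zero_le_one hK0.le]
  -- At level 6 log x each event has probability at most 2 x⁻⁶, which survives a union over at most
  -- x² events: x = n for the events indexed by classes, x = n ∨ p for those indexed by a coordinate
  -- and a class.
  have hexp : ∀ x : ℝ, 0 < x → Real.exp (-(6 * Real.log x)) = (x ^ 6)⁻¹ := fun x hx => by
    rw [Real.exp_neg, ← Real.exp_log (pow_pos hx 6), Real.log_pow]
    norm_num
  have hlogn : 6 * Real.log n ≤ n := by nlinarith [mul_le_mul hK hL1 zero_le_one hK0.le]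
  have eA := fun ℓ : Fin L => hP.measureReal_frequency_deviation_le (by omega) hD hind ℓ
    (s := 6 * Real.log n) (by positivity) (by
      have hπL : 1 ≤ classProb P ℓ * (K * L) := by
        have := hπ1 ℓ
        rwa [inv_le_iff_one_le_mul₀' (hP.classProb_pos ℓ)] at this
      have hπ := hP.classProb_pos ℓ
      calc 6 * Real.log n ≤ 96 * Real.log n * 1 := by linarith
        _ ≤ 96 * Real.log n * (classProb P ℓ * (K * L)) := by gcongr
        _ = 96 * K * (L * Real.log n) * classProb P ℓ := by ring
        _ ≤ n * classProb P ℓ := mul_le_mul_of_nonneg_right hlog hπ.le)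
  have hquad : ∀ k, (fun j => discB SW M j k) ⬝ᵥ (SW *ᵥ fun j => discB SW M j k) ≤ K := fun k => by
    rw [discB_dotProduct_mulVec hP.posDef]
    exact (le_abs_self _).trans (hG k k)
  have hmean : ∀ k ℓ, |∑ j, discB SW M j k * M j ℓ| ≤ K := fun k ℓ => by
    rw [sum_discB_mul hP.posDef]; exact hG k ℓ
  have eB := fun q : Fin L × Fin L => hP.measureReal_moment_deviation_le (by omega) hD hind hK0
    (hmean q.1) (hquad q.1) (hmean q.2) (hquad q.2) (s := 6 * Real.log n) (by positivity) hlogn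
  have eC := fun q : Fin L × Fin L => hP.measureReal_class_sum_deviation_le hD hind q.2
    (hquad q.1) (Real.sqrt (6 * Real.log n / (n * classProb P q.2 * K))) (6 * Real.log n)
  have eE := fun q : Fin p × Fin L => hP.measureReal_class_sum_deviation_le hD hind q.2
    (v := Pi.single q.1 1) (K := K) (by simpa using hSW q.1)
    (Real.sqrt (6 * Real.log m / (n * classProb P q.2 * K))) (6 * Real.log m)
  rw [hexp _ hn0] at eA eB eC
  rw [hexp _ hm0] at eE
  have uA := measureReal_setOf_exists_le eA
  have uB := measureReal_setOf_exists_le eB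
  have uC := measureReal_setOf_exists_le eC
  have uE := measureReal_setOf_exists_le eE
  simp only [Fintype.card_prod, Fintype.card_fin, Nat.cast_mul, Set.mem_ofPred_eq] at uA uB uC uE
  refine (le_trans ?_ (add_le_add uA (add_le_add uB (add_le_add uC uE)))).trans ?_
  · refine measureReal_le_add_of_forall_notMem fun ω h1 h2 h3 h4 hω => ?_
    refine hω (goodSample_of_deviations hn hK hP hL hπ1 hπ2 hlog (fun ℓ => ?_) (fun k ℓ => ?_)
      (fun k ℓ => ?_) (fun j ℓ => ?_))
    · exact not_lt.1 fun h => h1 ⟨ℓ, h⟩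
    · exact not_lt.1 fun h => h2 ⟨(k, ℓ), h⟩
    · exact not_le.1 fun h => h3 ⟨(k, ℓ), h⟩
    · exact not_le.1 fun h => h4 ⟨(j, ℓ), h⟩
  have hn4 : (0 : ℝ) < n ^ 4 := by positivity
  have b1 : (L : ℝ) * (2 * ((n : ℝ) ^ 6)⁻¹) ≤ 2 / n ^ 4 := by
    calc (L : ℝ) * (2 * ((n : ℝ) ^ 6)⁻¹) ≤ n * n * (2 * ((n : ℝ) ^ 6)⁻¹) := by
          gcongr; nlinarith
      _ = 2 / n ^ 4 := by field_simp
  have b2 : (L : ℝ) * L * (2 * ((n : ℝ) ^ 6)⁻¹) ≤ 2 / n ^ 4 := by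
    calc (L : ℝ) * L * (2 * ((n : ℝ) ^ 6)⁻¹) ≤ n * n * (2 * ((n : ℝ) ^ 6)⁻¹) := by gcongr
      _ = 2 / n ^ 4 := by field_simp
  have b3 : (p : ℝ) * L * (2 * (m ^ 6)⁻¹) ≤ 2 / n ^ 4 := by
    calc (p : ℝ) * L * (2 * (m ^ 6)⁻¹) ≤ m * m * (2 * (m ^ 6)⁻¹) := by
          gcongr; linarith
      _ = 2 / m ^ 4 := by field_simp
      _ ≤ 2 / n ^ 4 := by gcongr
  -- The total 8/n⁴ is at most 1/n since n ≥ 3.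
  have b4 : 2 / (n : ℝ) ^ 4 + (2 / n ^ 4 + (2 / n ^ 4 + 2 / n ^ 4)) ≤ 1 / n := by
    have : 2 / (n : ℝ) ^ 4 + (2 / n ^ 4 + (2 / n ^ 4 + 2 / n ^ 4)) = 8 / n ^ 4 := by ring
    rw [this, div_le_div_iff₀ hn4 hn0, one_mul]
    have : (3 : ℝ) ^ 3 ≤ n ^ 3 := by gcongr
    nlinarith
  linarith

end GoodSample

/-! ### The error measure on a good sample -/

section ErrorBound

open scoped Matrix.Norms.L2Operator

variable {n p L : ℕ} {P : Measure (Obs p L)} {M : Matrix (Fin p) (Fin L) ℝ}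
  {SW : Matrix (Fin p) (Fin p) ℝ}

theorem pinv_eq_nonsing_inv {ι : Type*} [Fintype ι] [DecidableEq ι] {A : Matrix ι ι ℝ}
    (hA : IsUnit A) : pinv A = A⁻¹ := by
  have hdet := (isUnit_iff_isUnit_det A).1 hA
  refine (pinv_spec A).unique ⟨?_, ?_, ?_, ?_⟩
  · rw [mul_nonsing_inv _ hdet, one_mul]
  · rw [nonsing_inv_mul _ hdet, one_mul]
  · rw [mul_nonsing_inv _ hdet, transpose_one]
  · rw [nonsing_inv_mul _ hdet, transpose_one]

theorem sqrt_transpose_mul_self (hSW : SW.PosDef) :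
    (CFC.sqrt SW)ᵀ * CFC.sqrt SW = SW := by
  have h1 : (CFC.sqrt SW)ᵀ = CFC.sqrt SW := by
    rw [← conjTranspose_eq_transpose_of_trivial]
    exact (nonneg_iff_posSemidef.1 (CFC.sqrt_nonneg SW)).isHermitian
  rw [h1, CFC.sqrt_mul_sqrt_self SW hSW.posSemidef.nonneg]

/-- The matrix S is taken to be the deviation of the sample second moments, so the second-moment
identity is automatic. Of the error bounds only the in-sample one enters here; the other two are
needed for the final estimate. -/
theorem GoodSample.perturbedRegression {D : Fin n → Obs p L} {K δ ρ ω₁ ω₂ : ℝ}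
    {Bhat : Matrix (Fin p) (Fin L) ℝ}
    (hgood : GoodSample P M SW K δ ρ D) (hP : IsLDAModel P M SW) (hL : 1 ≤ L) (hK : 1 ≤ K)
    (hδ0 : 0 ≤ δ) (hδ : 40 * K ^ 4 * δ ≤ 1) (hω : 40 * K ^ 4 * (ω₂ * Real.sqrt L) ≤ 1)
    (hπ1 : ∀ ℓ, (classProb P ℓ)⁻¹ ≤ K * L) (hπ2 : ∀ ℓ, classProb P ℓ ≤ K / L)
    (hG : ∀ k ℓ, |(Mᵀ * discB SW M) k ℓ| ≤ K) (herr : ErrorBounds P SW ω₁ ω₂ D Bhat) :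
    PerturbedRegression K δ ω₂ (classProb P) (fun ℓ => classCount D ℓ / n) (Mᵀ * discB SW M)
      (diagonal (fun ℓ => (classProb P ℓ)⁻¹) + Mᵀ * discB SW M)⁻¹
      ((scaledFeat D * discB SW M)ᵀ * (scaledFeat D * discB SW M) -
        Mᵀ * discB SW M * diagonal (classProb P) *
          (diagonal (fun ℓ => (classProb P ℓ)⁻¹) + Mᵀ * discB SW M))
      (discB SW M) (Bhat - regB P) (scaledFeat D) where
  one_le := hK
  card_pos := hL
  delta_nonneg := hδ0
  delta_le := hδ
  omega_le := hω
  weight_pos := hP.classProb_pos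
  weight_inv_le := hπ1
  weight_le := hπ2
  posSemidef := discB_gram_posSemidef hP.posDef
  gram_le := hG
  inv_mul := mul_nonsing_inv _ ((isUnit_iff_isUnit_det _).1 hP.posDef_inv_add_gram.isUnit)
  second_moment := by rw [add_sub_cancel]
  weight_sub_le := hgood.frequency
  moment_le := hgood.moment
  error_le := by
    rw [scaledFeat, Matrix.smul_mul, frobNorm_smul, abs_of_nonneg (by positivity)]
    exact (le_max_left _ _).trans herr.1

/-- The bound on the error measure of the plug-in estimate for a good sample. -/
theorem GoodSample.errQ_le {D : Fin n → Obs p L} {K Δ ω₁ ω₂ : ℝ}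
    {Bhat : Matrix (Fin p) (Fin L) ℝ} (hn : 3 ≤ n)
    (hgood : GoodSample P M SW K (Real.sqrt (L * Real.log n / n))
      (Real.sqrt (L * Real.log (max (n : ℝ) p) / n)) D)
    (hP : IsLDAModel P M SW) (hL : 1 ≤ L) (hK : 1 ≤ K) (hΔ0 : 0 ≤ Δ) (hΔ : Δ ≤ K)
    (hδ : 40 * K ^ 4 * Real.sqrt (L * Real.log n / n) ≤ 1)
    (hω : 40 * K ^ 4 * (ω₂ * Real.sqrt L) ≤ 1)
    (hπ1 : ∀ ℓ, (classProb P ℓ)⁻¹ ≤ K * L) (hπ2 : ∀ ℓ, classProb P ℓ ≤ K / L)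
    (hG : ∀ k ℓ, |(Mᵀ * discB SW M) k ℓ| ≤ K) (herr : ErrorBounds P SW ω₁ ω₂ D Bhat) :
    IsUnit (plugH D Bhat) ∧ errQ SW M Δ D (discEst D Bhat) ≤
      2400 * K ^ 11 * ((L : ℝ) ^ 2 * Real.log n ^ 2 / n + ω₂ ^ 2 * (L : ℝ) ^ 2 * Real.log n +
        ω₁ ^ 2 * (L : ℝ) ^ 3 * Real.log (max (n : ℝ) p) / n) := by
  have hn3 : (3 : ℝ) ≤ n := by exact_mod_cast hn
  have hn0 : (0 : ℝ) < n := by linarith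
  have hL1 : (1 : ℝ) ≤ L := by exact_mod_cast hL
  have hL0 : (0 : ℝ) < L := by linarith
  have hK0 : 0 < K := by linarith
  have hlog1 : 1 ≤ Real.log n := by
    rw [Real.le_log_iff_exp_le hn0]
    linarith [Real.exp_one_lt_d9]
  have hlogm : 0 ≤ Real.log (max (n : ℝ) p) :=
    Real.log_nonneg (le_trans (by linarith) (le_max_left _ _))
  have h := hgood.perturbedRegression hP hL hK (Real.sqrt_nonneg _) hδ hω hπ1 hπ2 hG herr
  set E := Bhat - regB P with hE
  set β := discB SW M with hβ
  set H := (diagonal (fun ℓ => (classProb P ℓ)⁻¹) + Mᵀ * β)⁻¹ with hH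
  have hB : β * H + E = Bhat := by rw [hE, hP.regB_eq, add_sub_cancel]
  have hplug := plugH_eq D Bhat
  obtain ⟨hunit, hnorm⟩ := h.isUnit_plugin
  rw [hB, ← hplug] at hunit hnorm
  refine ⟨hunit, ?_⟩
  set T := (plugH D Bhat)⁻¹ with hT
  have hest : discEst D Bhat = (β * H + E) * T := by
    rw [discEst, pinv_eq_nonsing_inv hunit, hB]
  have hT1 : (diagonal (fun ℓ => classCount D ℓ / n) -
      (scaledFeat D * (β * H + E))ᵀ * (scaledFeat D * (β * H + E))) * T = 1 := by
    rw [hB, ← hplug]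
    exact mul_nonsing_inv _ ((isUnit_iff_isUnit_det _).1 hunit)
  have hA : (CFC.sqrt SW * β)ᵀ * (CFC.sqrt SW * β) = Mᵀ * β := by
    rw [transpose_mul, Matrix.mul_assoc, ← Matrix.mul_assoc _ (CFC.sqrt SW),
      sqrt_transpose_mul_self hP.posDef, discB_quadratic hP.posDef]
  have part1 := h.frobNorm_plugin_error_le hT1 hnorm (CFC.sqrt SW) hA
    ((le_max_right _ _).trans herr.1)
  have part2 := h.sum_mean_error_le hT1 hnorm (Matrix.of fun j ℓ => meanEst D j ℓ - M j ℓ)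
    hgood.mean herr.2 hgood.projected_mean
  rw [← hest] at part1 part2
  rw [errQ]
  set l := Real.log n with hl
  set lm := Real.log (max (n : ℝ) p) with hlm
  have hδδ : Real.sqrt (L * l / n) ^ 2 = L * l / n := Real.sq_sqrt (by positivity)
  have hρρ : Real.sqrt (L * lm / n) ^ 2 = L * lm / n := Real.sq_sqrt (by positivity)
  have hω0 := h.omega_nonneg
  have hs : (Real.sqrt (L * l / n) / Real.sqrt L) ^ 2 = l / n := by
    rw [div_pow, hδδ, Real.sq_sqrt hL0.le]; field_simp
  -- The constant is 2304 = 24² · 2 · 2: one factor 2 from squaring the sum ω₂ + δ/√L, the other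
  -- from Δ + log n ≤ 2K log n, which uses Δ ≤ K and log n ≥ 1.
  have hfirst : frobNorm (CFC.sqrt SW * (discEst D Bhat - β)) ^ 2 * (Δ + l) ≤
      2304 * K ^ 11 * ((L : ℝ) ^ 2 * l ^ 2 / n + ω₂ ^ 2 * (L : ℝ) ^ 2 * l) := by
    set s := Real.sqrt (L * l / n) / Real.sqrt L with hsdef
    have a1 : frobNorm (CFC.sqrt SW * (discEst D Bhat - β)) ^ 2 ≤
        (24 * K ^ 5 * L) ^ 2 * (2 * (ω₂ ^ 2 + l / n)) := by
      refine (pow_le_pow_left₀ (frobNorm_nonneg _) part1 2).trans ?_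
      rw [mul_pow, ← hs]
      refine mul_le_mul_of_nonneg_left ?_ (by positivity)
      nlinarith [sq_nonneg (ω₂ - s)]
    have a2 : Δ + l ≤ 2 * K * l := by nlinarith
    calc _ ≤ (24 * K ^ 5 * L) ^ 2 * (2 * (ω₂ ^ 2 + l / n)) * (2 * K * l) :=
          mul_le_mul a1 a2 (by linarith) (by positivity)
      _ = _ := by ring
  have hsecond : ∑ ℓ : Fin L, (∑ j : Fin p, (meanEst D j ℓ - M j ℓ) *
      (discEst D Bhat j ℓ - β j ℓ)) ^ 2 ≤
      32 * K ^ 4 * (ω₁ ^ 2 * (L : ℝ) ^ 3 * lm / n) + 20 * K ^ 2 * ((L : ℝ) ^ 2 * l ^ 2 / n) := by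
    refine part2.trans ?_
    rw [mul_pow, hδδ, hρρ]
    -- Only one logarithm occurs here; since log n ≥ 1 it fits under the log² n of the first part.
    have b1 : L * l / n * L ≤ (L : ℝ) ^ 2 * l ^ 2 / n := by
      have hll : l ≤ l ^ 2 := by nlinarith
      calc L * l / n * L = (L : ℝ) ^ 2 * l / n := by ring
        _ ≤ _ := by gcongr
    have b2 : 32 * K ^ 2 * (K ^ 2 * (L * lm / n) * ω₁ ^ 2 * (L : ℝ) ^ 2) =
        32 * K ^ 4 * (ω₁ ^ 2 * (L : ℝ) ^ 3 * lm / n) := by ring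
    rw [b2]
    gcongr
  have hK2 : K ^ 2 ≤ K ^ 11 := pow_le_pow_right₀ hK (by norm_num)
  have hK4 : K ^ 4 ≤ K ^ 11 := pow_le_pow_right₀ hK (by norm_num)
  have x1 : 0 ≤ (L : ℝ) ^ 2 * l ^ 2 / n := by positivity
  have x2 : 0 ≤ ω₂ ^ 2 * (L : ℝ) ^ 2 * l := by positivity
  have x3 : 0 ≤ ω₁ ^ 2 * (L : ℝ) ^ 3 * lm / n := by positivity
  have y1 := mul_le_mul_of_nonneg_right hK2 x1
  have y2 := mul_le_mul_of_nonneg_right hK4 x3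
  have z0 : 0 ≤ K ^ 11 := by positivity
  have z1 := mul_nonneg z0 x1
  have z2 := mul_nonneg z0 x2
  have z3 := mul_nonneg z0 x3
  linarith

end ErrorBound

end LDARegression

/-! ### Assembly of the theorem -/

theorem theorem3
    -- the absolute constants of the standing assumptions
    (cπ Cπ cs Cs cΔ CΔ cW CW : ℝ)
    (hcπ : 0 < cπ) (hcπCπ : cπ ≤ Cπ) (hcs : 0 < cs) (hcsCs : cs ≤ Cs)
    (hcΔ : 0 < cΔ) (hcΔCΔ : cΔ ≤ CΔ) (hcW : 0 < cW) (hcWCW : cW ≤ CW) :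
    -- the small constant `c` and the constant `C` of the bound depend on these only
    ∃ c : ℝ, 0 < c ∧ ∃ C : ℝ, 0 < C ∧
      ∀ (n p L : ℕ), 1 ≤ n → 2 ≤ L →
      ∀ (P : Measure (Obs p L)) (M : Matrix (Fin p) (Fin L) ℝ)
        (SW : Matrix (Fin p) (Fin p) ℝ) (Δ : ℝ),
      IsLDAModel P M SW →
      -- the class probabilities are balanced
      (∀ ℓ : Fin L, cπ / L ≤ classProb P ℓ ∧ classProb P ℓ ≤ Cπ / L) →
      -- the classes are separated at the level `Δ`, and `Δ` is of constant order
      (∀ k ℓ : Fin L, k ≠ ℓ → cs * Δ ≤ mahal SW M k ℓ ∧ mahal SW M k ℓ ≤ Cs * Δ) →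
      cΔ ≤ Δ → Δ ≤ CΔ →
      -- the eigenvalues of `SW` are bounded below and its entries are bounded
      (∀ t ∈ spectrum ℝ SW, cW < t) → (∀ i j, |SW i j| ≤ CW) →
      (L : ℝ) * Real.log n ≤ c * n →
      -- the training data: `n` independent copies of `(X, Y)`
      ∀ (Ω : Type*) [MeasurableSpace Ω] (μ : Measure Ω) [IsProbabilityMeasure μ]
        (D : Fin n → Ω → Obs p L),
      (∀ i, HasLaw (D i) P μ) → iIndepFun D μ →
      -- any estimator of `B` with the required error bounds
      ∀ (Bhat : Ω → Matrix (Fin p) (Fin L) ℝ), (∀ j ℓ, Measurable fun ω => Bhat ω j ℓ) →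
      ∀ ω₁ ω₂ : ℝ,
      1 - 1 / (n : ℝ) ≤ μ.real {ω | ErrorBounds P SW ω₁ ω₂ (fun i => D i ω) (Bhat ω)} →
      ω₂ * Real.sqrt L ≤ c →
      1 - 2 / (n : ℝ) ≤ μ.real {ω |
        IsUnit (plugH (fun i => D i ω) (Bhat ω)) ∧
        errQ SW M Δ (fun i => D i ω) (discEst (fun i => D i ω) (Bhat ω)) ≤
          C * ((L : ℝ) ^ 2 * Real.log n ^ 2 / n + ω₂ ^ 2 * (L : ℝ) ^ 2 * Real.log n +
            ω₁ ^ 2 * (L : ℝ) ^ 3 * Real.log (max (n : ℝ) p) / n)} := by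
  have hCs : 0 < Cs := hcs.trans_le hcsCs
  have hCπ : 0 < Cπ := hcπ.trans_le hcπCπ
  have hCΔ : 0 < CΔ := hcΔ.trans_le hcΔCΔ
  have hCW : 0 < CW := hcW.trans_le hcWCW
  -- A single constant dominates all quantities of the assumptions. The larger constant `S` then
  -- governs the perturbation step, because the sample deviations are controlled only up to
  -- `sampleConst K`.
  obtain ⟨K, hK1, hKinv, hKπ, hKs, hKΔ, hKW⟩ : ∃ K : ℝ, 1 ≤ K ∧ cπ⁻¹ ≤ K ∧ Cπ ≤ K ∧
      Cs * CΔ ≤ K ∧ CΔ ≤ K ∧ CW ≤ K := by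
    have h1 : 0 < cπ⁻¹ := inv_pos.2 hcπ
    have h2 : 0 < Cs * CΔ := mul_pos hCs hCΔ
    refine ⟨1 + cπ⁻¹ + Cπ + Cs * CΔ + CΔ + CW, ?_, ?_, ?_, ?_, ?_, ?_⟩ <;> linarith
  have hK0 : 0 < K := by linarith
  set S := sampleConst K with hS
  have hSK : 10 * K ≤ S := le_sampleConst
  have hKS : K ≤ S := by linarith
  have hS1 : 1 ≤ S := by linarith
  have hS0 : 0 < S := by linarith
  -- The square is dictated by δ = √(L log n / n), which has to be at most 1/(40 S⁴); being below
  -- 1/(40 S⁴) itself, the same number also serves for ω₂√L.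
  refine ⟨(1 / (40 * S ^ 4)) ^ 2, by positivity, 2400 * S ^ 11, by positivity, ?_⟩
  intro n p L hn hL P M SW Δ hP hπ hmahal hΔ1 hΔ2 _ hSW hlog Ω _ μ _ D hD hind Bhat _ ω₁ ω₂ hprob
    hω
  -- For n ≤ 2 the claimed probability 1 − 2/n is not positive.
  rcases Nat.lt_or_ge n 3 with hn3 | hn3
  · refine le_trans ?_ measureReal_nonneg
    have hn0 : (0 : ℝ) < n := by exact_mod_cast hn
    have hn2 : (n : ℝ) ≤ 2 := by exact_mod_cast Nat.le_of_lt_succ hn3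
    rw [sub_nonpos, le_div_iff₀ hn0]
    linarith
  have hn0 : (0 : ℝ) < n := by exact_mod_cast hn
  have hL1 : 1 ≤ L := by omega
  have hL0 : (0 : ℝ) < L := by exact_mod_cast hL1
  have hlog0 : 0 ≤ Real.log n := Real.log_natCast_nonneg n
  have hS4 : (1 : ℝ) ≤ S ^ 4 := one_le_pow₀ hS1
  have hπ1 : ∀ ℓ, (classProb P ℓ)⁻¹ ≤ K * L := fun ℓ => by
    calc (classProb P ℓ)⁻¹ ≤ (cπ / L)⁻¹ := inv_anti₀ (by positivity) (hπ ℓ).1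
      _ = cπ⁻¹ * L := by rw [inv_div, div_eq_inv_mul]
      _ ≤ K * L := by gcongr
  have hπ2 : ∀ ℓ, classProb P ℓ ≤ K / L := fun ℓ => (hπ ℓ).2.trans (by gcongr)
  have hG : ∀ k ℓ, |(Mᵀ * discB SW M) k ℓ| ≤ K := by
    refine hP.abs_gram_le fun k ℓ => ?_
    -- The separation assumption concerns distinct classes; on the diagonal the distance is zero.
    by_cases hkℓ : k = ℓ
    · subst hkℓ
      rw [mahal_eq hP.posDef]
      linarith
    · exact (hmahal k ℓ hkℓ).2.trans (le_trans (by gcongr) hKs)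
  have hlog' : 96 * K * (L * Real.log n) ≤ n := by
    have h1 : 96 * K * (1 / (40 * S ^ 4)) ^ 2 ≤ 1 := by
      rw [div_pow, one_pow, mul_one_div, div_le_one (by positivity)]
      have : S ≤ S ^ 4 := le_self_pow₀ hS1 (by norm_num)
      nlinarith
    calc 96 * K * (L * Real.log n) ≤ 96 * K * ((1 / (40 * S ^ 4)) ^ 2 * n) := by gcongr
      _ = 96 * K * (1 / (40 * S ^ 4)) ^ 2 * n := by ring
      _ ≤ 1 * n := by gcongr
      _ = n := one_mul _
  have hδ : 40 * S ^ 4 * Real.sqrt (L * Real.log n / n) ≤ 1 := by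
    have : Real.sqrt (L * Real.log n / n) ≤ 1 / (40 * S ^ 4) := by
      rw [Real.sqrt_le_left (by positivity), div_le_iff₀ hn0]
      exact hlog
    calc _ ≤ 40 * S ^ 4 * (1 / (40 * S ^ 4)) := by gcongr
      _ = 1 := by field_simp
  have hω' : 40 * S ^ 4 * (ω₂ * Real.sqrt L) ≤ 1 := by
    have h1 : (1 / (40 * S ^ 4)) ^ 2 ≤ 1 / (40 * S ^ 4) := by
      refine pow_le_of_le_one (by positivity) ?_ two_ne_zero
      rw [div_le_one (by positivity)]
      linarith
    calc _ ≤ 40 * S ^ 4 * (1 / (40 * S ^ 4)) := by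
          refine mul_le_mul_of_nonneg_left (hω.trans h1) (by positivity)
      _ = 1 := by field_simp
  have hbad := hP.measureReal_not_goodSample_le hn3 hD hind hK1 hL1 hπ1 hπ2 hG
    (fun j => (le_abs_self _).trans ((hSW j j).trans hKW)) hlog'
  have hsub : {ω | ErrorBounds P SW ω₁ ω₂ (fun i => D i ω) (Bhat ω)} ⊆
      {ω | IsUnit (plugH (fun i => D i ω) (Bhat ω)) ∧
        errQ SW M Δ (fun i => D i ω) (discEst (fun i => D i ω) (Bhat ω)) ≤
          2400 * S ^ 11 * ((L : ℝ) ^ 2 * Real.log n ^ 2 / n +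
            ω₂ ^ 2 * (L : ℝ) ^ 2 * Real.log n +
            ω₁ ^ 2 * (L : ℝ) ^ 3 * Real.log (max (n : ℝ) p) / n)} ∪
      {ω | ¬ GoodSample P M SW S (Real.sqrt (L * Real.log n / n))
        (Real.sqrt (L * Real.log (max (n : ℝ) p) / n)) fun i => D i ω} := by
    intro ω herr
    by_cases hgood : GoodSample P M SW S (Real.sqrt (L * Real.log n / n))
        (Real.sqrt (L * Real.log (max (n : ℝ) p) / n)) fun i => D i ω
    · exact Or.inl (hgood.errQ_le hn3 hP hL1 hS1 (by linarith) (by linarith) hδ hω'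
        (fun ℓ => (hπ1 ℓ).trans (by gcongr)) (fun ℓ => (hπ2 ℓ).trans (by gcongr))
        (fun k ℓ => (hG k ℓ).trans hKS) herr)
    · exact Or.inr hgood
  -- Monotonicity and subadditivity hold for arbitrary sets, so measurability of the events is not
  -- required.
  have hfin := (measureReal_mono hsub (μ := μ)).trans (measureReal_union_le _ _)
  have h2 : (2 : ℝ) / n = 1 / n + 1 / n := by ring
  rw [h2]
  linarith
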